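/- Let $p>1$ be an integer, and let $e_1=p^2+p+1$, $e_2=p^2-p+1$, $e_3=p^4-p^2+1$, $\mathscr{P}=\mathbb{Z}_{e_1}\times\mathbb{Z}_{e_2}\times\mathbb{Z}_{e_3}$ and $m=\frac{p^2-p}{2}$. Let $G=\mathrm{Sym}(\mathbb{Z}_{e_1})\times\mathrm{Sym}(\mathbb{Z}_{e_2})\times\mathrm{Sym}(\mathbb{Z}_{e_3})$ act on $\mathscr{P}$ coordinatewise. Let $B=B_1\cup B_2\cup B_3\subseteq\mathscr{P}$, where $$B_1=\{(a,0,0)\mid 0\le a\le p\},\qquad B_2=\{(p+a,2a-1,0),\,(p+a,2a,0)\mid 1\le a\le m\},$$ and $B_3$ is defined as follows. If $p=2$, then $B_3$ consists of the points $(3+a,b,c-1)$ and $(3+a,b,c)$ with $1\le a\le 3$, $1\le b\le 2$, $c=2(a+3(b-1))$. If $p>2$, then $B_3=B_{3,1}\cup B_{3,2}\cup B_{3,3}\cup B_{3,4}$. Put $r=\frac{p^2-1}{2}$, $r'=\frac{p^2-2p+1}{2}$, $n=\frac{p^4+p^2-2p}{4}$ if $p$ is odd, and $r=\frac{p^2-2p}{2}$,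 $r'=\frac{p^2}{2}$, $n=\frac{p^4-3p^2}{4}$ if $p$ is even. Then - $B_{3,1}$ consists of the points $(a,b,c-1)$ and $(a,b,c)$ with $1\le a\le p$, $1\le b\le r$, $c=2(a+(b-1)p)$; - $B_{3,2}$ consists of the points $(p+a,b+\delta,c-1)$ and $(p+a,b+\delta,c)$ with $1\le a\le m$, $1\le b\le m$, $c=2pr+2(a+(b-1)m)$, where $\delta=m$ if $a\le\lfloor\frac{p^2-p+2}{4}\rfloor$ and $b\in\{2a-1,2a\}$, and $\delta=0$ otherwise; - $B_{3,3}$ consists of the points $(\frac{p^2+p}{2}+a,\,r+b,\,c-1)$ and $(\frac{p^2+p}{2}+a,\,r+b,\,c)$ with $1\le a\le p$, $1\le b\le r'$, $c=2n+2(a+(b-1)p)$; - $B_{3,4}$ consists of the points $(\frac{p^2+3p}{2}+a,\,b+\delta,\,c-1)$ and $(\frac{p^2+3p}{2}+a,\,b+\delta,\,c)$ with $1\le a\le m$, $1\le b\le m$, $c=2\cdot\frac{p^4+2p^3-3p^2}{4}+2(a+(b-1)m)$, where $\delta=0$ if $a=1$, and $\delta=m$ otherwise. Let $\mathscr{D}(3,p)$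 be the incidence structure with point set $\mathscr{P}$ and block set $\{B^g\mid g\in G\}$. A permutation group $H$ on a set $\mathscr{P}$ is called $3$-grid-imprimitive if $\mathscr{P}$ can be identified with a Cartesian product $\mathscr{E}_1\times\mathscr{E}_2\times\mathscr{E}_3$ of finite sets with $|\mathscr{E}_i|>1$ for each $i$, in such a way that $H\le\mathrm{Sym}(\mathscr{E}_1)\times\mathrm{Sym}(\mathscr{E}_2)\times\mathrm{Sym}(\mathscr{E}_3)$ in its coordinatewise action. Then $\mathscr{D}(3,p)$ is a $2$-$(p^8+p^4+1,\,p^4+1,\,\lambda)$ design for some $\lambda\ge 1$; that is, $|\mathscr{P}|=p^8+p^4+1$, every block has exactly $p^4+1$ points, and every two distinct points lie in exactly $\lambda$ common blocks. Moreover $G$ is a group of automorphisms of $\mathscr{D}(3,p)$ that is transitive on its blocks, and $G$ is $3$-grid-imprimitive, with respect to the grid $\mathbb{Z}_{e_1}\times\mathbb{Z}_{e_2}\times\mathbb{Z}_{e_3}$. -/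

import Mathlib

/-! ### Designs, grids and groups acting on them -/

/-- The set `blocks` of subsets of the point set `P` is (the block set of) a
`t`-`(v, k, l)` design: there are `v` points, every block has `k` points, and every set of
`t` points lies in exactly `l` blocks, where `l ≥ 1`. Blocks are not repeated. -/
structure IsDesign {P : Type*} (t v k l : ℕ) (blocks : Set (Set P)) : Prop where
  finite_points : Finite P
  card_points : Nat.card P = v
  le_block_size : t ≤ k
  block_size_le : k ≤ v
  index_pos : 0 < l
  card_block : ∀ C ∈ blocks, C.ncard = k
  card_blocks_through : ∀ T : Set P, T.ncard = t → {C ∈ blocks | T ⊆ C}.ncard = l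

/-- The group `Sym(E₁) × ⋯ × Sym(Eₛ)` in its product action on the grid `E₁ × ⋯ × Eₛ`, where
`(g₁, …, gₛ)` maps `(δ₁, …, δₛ)` to `(g₁ δ₁, …, gₛ δₛ)`, as a group of permutations of the grid. -/
def gridGroup {s : ℕ} (E : Fin s → Type*) : Subgroup (Equiv.Perm (∀ i, E i)) :=
  (MulAction.toPermHom (∀ i, Equiv.Perm (E i)) (∀ i, E i)).range

/-- The bijection `φ` from `P` to the `s`-dimensional grid `E₁ × ⋯ × Eₛ`, where `s ≥ 2` and all
`Eᵢ` are finite with more than one element, identifies the permutation group `H` of `P` with a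
subgroup of `Sym(E₁) × ⋯ × Sym(Eₛ)` in product action. -/
structure IsGridImprimitiveVia {P : Type*} {s : ℕ} {E : Fin s → Type*} (φ : P ≃ (∀ i, E i))
    (H : Subgroup (Equiv.Perm P)) : Prop where
  two_le_dim : 2 ≤ s
  finite_side : ∀ i, Finite (E i)
  one_lt_side : ∀ i, 1 < Nat.card (E i)
  le_gridGroup : ∀ h ∈ H, φ.permCongr h ∈ gridGroup E

/-- The permutation group `H` of `P` is `s`-grid-imprimitive: `P` can be identified with an
`s`-dimensional grid in such a way that `H` is a subgroup of `Sym(E₁) × ⋯ × Sym(Eₛ)`. -/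
def IsGridImprimitive.{u} {P : Type u} (s : ℕ) (H : Subgroup (Equiv.Perm P)) : Prop :=
  ∃ (E : Fin s → Type u) (φ : P ≃ (∀ i, E i)), IsGridImprimitiveVia φ H

/-- The block set `B^H` of the incidence structure `D(B, H)`: all images of `B` under `H`. -/
def blockOrbit {P : Type*} (B : Set P) (H : Subgroup (Equiv.Perm P)) : Set (Set P) :=
  {C | ∃ g ∈ H, C = g '' B}

/-- Every element of `H` is an automorphism of the incidence structure `(P, blocks)`. -/
def IsAutomorphismGroup {P : Type*} (H : Subgroup (Equiv.Perm P)) (blocks : Set (Set P)) : Prop :=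
  ∀ g ∈ H, ∀ C : Set P, g '' C ∈ blocks ↔ C ∈ blocks

/-- `H` is a group of automorphisms of `(P, blocks)` that is transitive on the blocks. -/
def IsBlockTransitive {P : Type*} (H : Subgroup (Equiv.Perm P)) (blocks : Set (Set P)) : Prop :=
  IsAutomorphismGroup H blocks ∧ blocks.Nonempty ∧
    ∀ C ∈ blocks, ∀ D ∈ blocks, ∃ g ∈ H, g '' C = D

/-! ### The construction

All natural number subtractions below are of the form `x - y` with `y ≤ x`, and all divisions
are exact, for the `p`, `a`, `b` where they are used, except the division by `4` in
`shift32`, which is a floor. -/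

/-- The sides `e₁ = p² + p + 1`, `e₂ = p² - p + 1`, `e₃ = p⁴ - p² + 1` of the grid. -/
def gridSize (p : ℕ) : Fin 3 → ℕ :=
  ![p ^ 2 + p + 1, p ^ 2 - p + 1, p ^ 4 - p ^ 2 + 1]

/-- The point set `ℤ_{e₁} × ℤ_{e₂} × ℤ_{e₃}`. -/
abbrev Grid (p : ℕ) : Type := ∀ i : Fin 3, ZMod (gridSize p i)

/-- The point with coordinates (the residue classes of) `x`, `y`, `z`. -/
def gridPoint (p x y z : ℕ) : Grid p := fun i => ((![x, y, z] i : ℕ) : ZMod (gridSize p i))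

/-- The pair of points `(x, y, c - 1)` and `(x, y, c)`. -/
def layerPair (p x y c : ℕ) : Set (Grid p) := {gridPoint p x y (c - 1), gridPoint p x y c}

/-- `B₁ × {0}`: the points `(a, 0, 0)` with `0 ≤ a ≤ p`. -/
def block1 (p : ℕ) : Set (Grid p) := {x | ∃ a : ℕ, a ≤ p ∧ x = gridPoint p a 0 0}

/-- `B₂ × {0}`: the points `(p + a, 2a - 1, 0)` and `(p + a, 2a, 0)` with
`1 ≤ a ≤ (p² - p) / 2`. -/
def block2 (p : ℕ) : Set (Grid p) :=
  {x | ∃ a : ℕ, 1 ≤ a ∧ a ≤ (p ^ 2 - p) / 2 ∧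
    (x = gridPoint p (p + a) (2 * a - 1) 0 ∨ x = gridPoint p (p + a) (2 * a) 0)}

/-- The union of the pairs `(col a, row a b, c a b - 1)`, `(col a, row a b, c a b)` over
`1 ≤ a ≤ m` and `1 ≤ b ≤ n`. -/
def pairArray (p m n : ℕ) (col : ℕ → ℕ) (row c : ℕ → ℕ → ℕ) : Set (Grid p) :=
  {x | ∃ a b : ℕ, 1 ≤ a ∧ a ≤ m ∧ 1 ≤ b ∧ b ≤ n ∧ x ∈ layerPair p (col a) (row a b) (c a b)}

/-- The row shift `δ` used in `B_{3,2}`. -/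
def shift32 (p a b : ℕ) : ℕ :=
  if a ≤ (p ^ 2 - p + 2) / 4 ∧ (b = 2 * a - 1 ∨ b = 2 * a) then (p ^ 2 - p) / 2 else 0

/-- The row shift `δ` used in `B_{3,4}`. -/
def shift34 (p a : ℕ) : ℕ := if a = 1 then 0 else (p ^ 2 - p) / 2

/-- `B₃` for `p = 2`. -/
def block3Two : Set (Grid 2) :=
  pairArray 2 3 2 (fun a => 3 + a) (fun _ b => b) (fun a b => 2 * (a + 3 * (b - 1)))

/-- `B₃ = B_{3,1} ∪ B_{3,2} ∪ B_{3,3} ∪ B_{3,4}` for odd `p`. -/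
def block3Odd (p : ℕ) : Set (Grid p) :=
  pairArray p p ((p ^ 2 - 1) / 2) (fun a => a) (fun _ b => b)
    (fun a b => 2 * (a + (b - 1) * p)) ∪
  pairArray p ((p ^ 2 - p) / 2) ((p ^ 2 - p) / 2) (fun a => p + a) (fun a b => b + shift32 p a b)
    (fun a b => 2 * p * ((p ^ 2 - 1) / 2) + 2 * (a + (b - 1) * ((p ^ 2 - p) / 2))) ∪
  pairArray p p ((p ^ 2 - 2 * p + 1) / 2) (fun a => (p ^ 2 + p) / 2 + a)
    (fun _ b => (p ^ 2 - 1) / 2 + b)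
    (fun a b => 2 * ((p ^ 4 + p ^ 2 - 2 * p) / 4) + 2 * (a + (b - 1) * p)) ∪
  pairArray p ((p ^ 2 - p) / 2) ((p ^ 2 - p) / 2) (fun a => (p ^ 2 + 3 * p) / 2 + a)
    (fun a b => b + shift34 p a)
    (fun a b => 2 * ((p ^ 4 + 2 * p ^ 3 - 3 * p ^ 2) / 4) +
      2 * (a + (b - 1) * ((p ^ 2 - p) / 2)))

/-- `B₃ = B_{3,1} ∪ B_{3,2} ∪ B_{3,3} ∪ B_{3,4}` for even `p > 2`. -/
def block3Even (p : ℕ) : Set (Grid p) :=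
  pairArray p p ((p ^ 2 - 2 * p) / 2) (fun a => a) (fun _ b => b)
    (fun a b => 2 * (a + (b - 1) * p)) ∪
  pairArray p ((p ^ 2 - p) / 2) ((p ^ 2 - p) / 2) (fun a => p + a) (fun a b => b + shift32 p a b)
    (fun a b => 2 * p * ((p ^ 2 - 2 * p) / 2) + 2 * (a + (b - 1) * ((p ^ 2 - p) / 2))) ∪
  pairArray p p (p ^ 2 / 2) (fun a => (p ^ 2 + p) / 2 + a)
    (fun _ b => (p ^ 2 - 2 * p) / 2 + b)
    (fun a b => 2 * ((p ^ 4 - 3 * p ^ 2) / 4) + 2 * (a + (b - 1) * p)) ∪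
  pairArray p ((p ^ 2 - p) / 2) ((p ^ 2 - p) / 2) (fun a => (p ^ 2 + 3 * p) / 2 + a)
    (fun a b => b + shift34 p a)
    (fun a b => 2 * ((p ^ 4 + 2 * p ^ 3 - 3 * p ^ 2) / 4) +
      2 * (a + (b - 1) * ((p ^ 2 - p) / 2)))

/-- `B₃`, according to the three cases `p = 2`, `p` odd, and `p > 2` even. -/
def block3 : (p : ℕ) → Set (Grid p)
  | 2 => block3Two
  | p => if Odd p then block3Odd p else block3Even p

/-- The base block `B = B₁ × {0} ∪ B₂ × {0} ∪ B₃`. -/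
def baseBlock (p : ℕ) : Set (Grid p) := block1 p ∪ block2 p ∪ block3 p

/-- The group `G = S_{e₁} × S_{e₂} × S_{e₃}` acting on the point set. -/
def baseGroup (p : ℕ) : Subgroup (Equiv.Perm (Grid p)) :=
  gridGroup (fun i => ZMod (gridSize p i))

/-- The block set of `D(3, p) = D(B, G)`; its point set is `Grid p`. -/
def designBlocks (p : ℕ) : Set (Set (Grid p)) := blockOrbit (baseBlock p) (baseGroup p)

/-! The group `G` is transitive on the ordered pairs of points that differ in exactly a given set
`I` of coordinates (`exists_gridGroup_map_pair`), and there are `v ∏_{i ∈ I} (eᵢ - 1)` such pairs.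
Hence, if `B` contains exactly `∏_{i ∈ I} (eᵢ - 1)` of them for every nonempty `I`, then double
counting shows that every pair of points lies in `b / v` of the `b` blocks, whatever `I` is
(`isDesign_blockOrbit`).

To count the pairs in `B` it is enough, by inclusion-exclusion, to count the ordered pairs that
*agree* on each set `J` of coordinates; the required number is `p⁴ + ∏_{i ∉ J} eᵢ`, which gives
seven equations (`BalancedTriples`). All points of `B₁ ∪ B₂` lie in layer `0`, over a set `S₀` of
cells `(x, y)`, while `B₃` has two points over each cell of a set `S` disjoint from `S₀`, and these
points lie in pairwise distinct nonzero layers (`stackIndex_injOn`). So the seven counts only depend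
on the numbers of cells of `S₀` and `S` in the rows and columns of the `e₁ × e₂` grid
(`balancedTriples_layerSet`). With `m = (p² - p) / 2` and `r` the number of rows of `B_{3,1}`, for
`p > 2` every row but row `0` has `1` cell of `S₀` and `p + m` cells of `S`, row `0` has `p + 1`
cells of `S₀` and none of `S`, and the columns fall into runs of length `1, p, m, p, m` with
`1, 1, 2, 0, 0` cells of `S₀` and `0, r, m, 2m - r, m` cells of `S`. The seven equations become
polynomial identities in `p` (`balancedTriples_cells`), valid for both `2r = p² - 1` and
`2r = p² - 2p`. For `p = 2` the counts are evaluated directly. -/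

/-! ### Product action on a grid and pair counts -/

/-- The set of coordinates in which two points of a grid differ. -/
def diffSet {s : ℕ} {E : Fin s → Type*} [∀ i, DecidableEq (E i)] (x y : ∀ i, E i) :
    Finset (Fin s) := Finset.univ.filter fun i => x i ≠ y i

/-- The ordered pairs of points of `B` that differ in exactly the coordinates in `I`. -/
def diffPairs {s : ℕ} {E : Fin s → Type*} [∀ i, DecidableEq (E i)] (B : Set (∀ i, E i))
    (I : Finset (Fin s)) : Set ((∀ i, E i) × (∀ i, E i)) :=
  {q | q.1 ∈ B ∧ q.2 ∈ B ∧ diffSet q.1 q.2 = I}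

section GridGroup

variable {s : ℕ} {E : Fin s → Type*}

theorem mem_gridGroup_iff {h : Equiv.Perm (∀ i, E i)} :
    h ∈ gridGroup E ↔ ∃ g : ∀ i, Equiv.Perm (E i), ∀ x i, h x i = g i (x i) := by
  constructor
  · rintro ⟨g, rfl⟩
    exact ⟨g, fun x i => rfl⟩
  · rintro ⟨g, hg⟩
    exact ⟨g, Equiv.ext fun x => funext fun i => (hg x i).symm⟩

theorem image_mem_blockOrbit_iff {P : Type*} {H : Subgroup (Equiv.Perm P)} {B C : Set P}
    {g : Equiv.Perm P} (hg : g ∈ H) : g '' C ∈ blockOrbit B H ↔ C ∈ blockOrbit B H := by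
  constructor
  · rintro ⟨k, hk, h⟩
    refine ⟨g⁻¹ * k, H.mul_mem (H.inv_mem hg) hk, ?_⟩
    rw [Equiv.Perm.coe_mul, Set.image_comp, ← h, ← Set.image_comp, ← Equiv.Perm.coe_mul]
    simp
  · rintro ⟨k, hk, rfl⟩
    exact ⟨g * k, H.mul_mem hg hk, by rw [Equiv.Perm.coe_mul, Set.image_comp]⟩

theorem isBlockTransitive_blockOrbit {P : Type*} (H : Subgroup (Equiv.Perm P)) (B : Set P) :
    IsBlockTransitive H (blockOrbit B H) := by
  refine ⟨fun g hg C => image_mem_blockOrbit_iff hg, ⟨B, 1, H.one_mem, by simp⟩, ?_⟩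
  rintro _ ⟨g, hg, rfl⟩ _ ⟨k, hk, rfl⟩
  refine ⟨k * g⁻¹, H.mul_mem hk (H.inv_mem hg), ?_⟩
  rw [← Set.image_comp, ← Equiv.Perm.coe_mul]
  simp

theorem isGridImprimitiveVia_refl (hs : 2 ≤ s) (hE : ∀ i, Finite (E i))
    (hc : ∀ i, 1 < Nat.card (E i)) :
    IsGridImprimitiveVia (Equiv.refl (∀ i, E i)) (gridGroup E) :=
  ⟨hs, hE, hc, fun _ hh => hh⟩

variable [∀ i, DecidableEq (E i)]

theorem diffSet_gridGroup {h : Equiv.Perm (∀ i, E i)} (hh : h ∈ gridGroup E) (x y : ∀ i, E i) :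
    diffSet (h x) (h y) = diffSet x y := by
  obtain ⟨g, hg⟩ := mem_gridGroup_iff.1 hh
  ext i
  simp [diffSet, hg]

/-- The orbits of the grid group on ordered pairs of points are the sets of pairs with a given
set of differing coordinates. -/
theorem exists_gridGroup_map_pair {x y x' y' : ∀ i, E i} (h : diffSet x y = diffSet x' y') :
    ∃ g ∈ gridGroup E, g x = x' ∧ g y = y' := by
  have hi : ∀ i, x i = y i ↔ x' i = y' i := fun i => by
    have := Finset.ext_iff.1 h i
    simpa [diffSet, not_iff_not] using this
  -- After `x i` has been moved to `x' i`, the second swap fixes `x' i` if `x i ≠ y i`, and is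
  -- trivial otherwise.
  let k : ∀ i, Equiv.Perm (E i) := fun i =>
    Equiv.swap (Equiv.swap (x i) (x' i) (y i)) (y' i) * Equiv.swap (x i) (x' i)
  have hk1 : ∀ i, k i (x i) = x' i := fun i => by
    by_cases hxy : x i = y i
    · have h' := (hi i).1 hxy
      simp [k, ← hxy, ← h']
    · have h' : x' i ≠ y' i := fun h' => hxy ((hi i).2 h')
      simp only [k, Equiv.Perm.mul_apply, Equiv.swap_apply_left]
      refine Equiv.swap_apply_of_ne_of_ne (fun h'' => hxy ?_) h'
      apply (Equiv.swap (x i) (x' i)).injective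
      simpa using h''
  have hk2 : ∀ i, k i (y i) = y' i := fun i => by simp [k]
  exact ⟨_, ⟨k, rfl⟩, funext hk1, funext hk2⟩

theorem ncard_diffPairs_image {h : Equiv.Perm (∀ i, E i)} (hh : h ∈ gridGroup E)
    (B : Set (∀ i, E i)) (I : Finset (Fin s)) :
    (diffPairs (h '' B) I).ncard = (diffPairs B I).ncard := by
  rw [← Set.ncard_image_of_injective (diffPairs B I) (h.prodCongr h).injective]
  congr 1
  ext ⟨a, b⟩
  constructor
  · rintro ⟨⟨x, hx, rfl⟩, ⟨y, hy, rfl⟩, hI⟩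
    exact ⟨(x, y), ⟨hx, hy, by rw [← diffSet_gridGroup hh]; exact hI⟩, rfl⟩
  · rintro ⟨⟨x, y⟩, ⟨hx, hy, hI⟩, heq⟩
    obtain ⟨rfl, rfl⟩ := Prod.mk.inj heq
    exact ⟨⟨x, hx, rfl⟩, ⟨y, hy, rfl⟩, by rw [diffSet_gridGroup hh]; exact hI⟩

/-- The number of blocks on a pair of points only depends on the set of differing coordinates. -/
theorem ncard_blocks_through_eq (B : Set (∀ i, E i)) {x y x' y' : ∀ i, E i}
    (h : diffSet x y = diffSet x' y') :
    {C ∈ blockOrbit B (gridGroup E) | x ∈ C ∧ y ∈ C}.ncard =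
      {C ∈ blockOrbit B (gridGroup E) | x' ∈ C ∧ y' ∈ C}.ncard := by
  obtain ⟨g, hg, rfl, rfl⟩ := exists_gridGroup_map_pair h
  rw [← Set.ncard_image_of_injective _ (Set.image_injective.2 g.injective)]
  congr 1
  ext C
  constructor
  · rintro ⟨D, ⟨hD, hx, hy⟩, rfl⟩
    exact ⟨(image_mem_blockOrbit_iff hg).2 hD, ⟨x, hx, rfl⟩, ⟨y, hy, rfl⟩⟩
  · rintro ⟨hC, hx, hy⟩
    have hC' : g '' (g ⁻¹' C) = C := Set.image_preimage_eq _ g.surjective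
    exact ⟨g ⁻¹' C, ⟨(image_mem_blockOrbit_iff hg).1 (hC'.symm ▸ hC), hx, hy⟩, hC'⟩

variable [∀ i, Fintype (E i)]

theorem ncard_diffPairs_univ (I : Finset (Fin s)) :
    (diffPairs (Set.univ : Set (∀ i, E i)) I).ncard =
      Fintype.card (∀ i, E i) * ∏ i ∈ I, (Fintype.card (E i) - 1) := by
  classical
  -- The points that differ from `x` in exactly the coordinates in `I` form a product set.
  have key : ∀ x : ∀ i, E i, (Finset.univ.filter fun y => diffSet x y = I).card =
      ∏ i ∈ I, (Fintype.card (E i) - 1) := by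
    intro x
    have : (Finset.univ.filter fun y => diffSet x y = I) =
        Fintype.piFinset fun i => if i ∈ I then Finset.univ.erase (x i) else {x i} := by
      ext y
      simp only [Finset.mem_filter, Finset.mem_univ, true_and, Fintype.mem_piFinset,
        Finset.ext_iff, diffSet]
      refine forall_congr' fun i => ?_
      by_cases hi : i ∈ I
      · simp [hi, eq_comm]
      · simp [hi, eq_comm]
    rw [this, Fintype.card_piFinset, ← Finset.prod_subset (Finset.subset_univ I)]
    · refine Finset.prod_congr rfl fun i hi => ?_
      simp [hi, Finset.card_erase_of_mem]
    · intro i _ hi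
      simp [hi]
  rw [show diffPairs (Set.univ : Set (∀ i, E i)) I =
      ↑(Finset.univ.filter fun q : (∀ i, E i) × (∀ i, E i) => diffSet q.1 q.2 = I) by
    ext q; simp [diffPairs], Set.ncard_coe_finset, Finset.card_filter, Fintype.sum_prod_type]
  simp_rw [← Finset.card_filter, key]
  simp

/-- Counting the incidences of a block with a pair of points that differ exactly in `I`. -/
theorem ncard_pairs_mul_blocks_through (B : Set (∀ i, E i)) (x y : ∀ i, E i) :
    (diffPairs (Set.univ : Set (∀ i, E i)) (diffSet x y)).ncard *
        {C ∈ blockOrbit B (gridGroup E) | x ∈ C ∧ y ∈ C}.ncard =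
      (blockOrbit B (gridGroup E)).ncard * (diffPairs B (diffSet x y)).ncard := by
  classical
  set I := diffSet x y with hI
  set O := (diffPairs (Set.univ : Set (∀ i, E i)) I).toFinset with hO
  set D := (blockOrbit B (gridGroup E)).toFinset with hD
  have hmem : ∀ q, q ∈ O ↔ diffSet q.1 q.2 = I := fun q => by
    rw [hO, Set.mem_toFinset]
    simp [diffPairs]
  have h := Finset.sum_card_bipartiteAbove_eq_sum_card_bipartiteBelow
    (s := O) (t := D) (fun q C => q.1 ∈ C ∧ q.2 ∈ C)
  have h1 : ∀ q ∈ O, (D.bipartiteAbove (fun q C => q.1 ∈ C ∧ q.2 ∈ C) q).card =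
      {C ∈ blockOrbit B (gridGroup E) | x ∈ C ∧ y ∈ C}.ncard := by
    intro q hq
    have hq' : diffSet q.1 q.2 = I := (hmem q).1 hq
    rw [← ncard_blocks_through_eq B (hq'.trans hI), ← Set.ncard_coe_finset]
    congr 1
    ext C
    simp [hD, Finset.bipartiteAbove]
  have h2 : ∀ C ∈ D, (O.bipartiteBelow (fun q C => q.1 ∈ C ∧ q.2 ∈ C) C).card =
      (diffPairs B I).ncard := by
    intro C hC
    obtain ⟨g, hg, rfl⟩ : C ∈ blockOrbit B (gridGroup E) := by simpa [hD] using hC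
    rw [← ncard_diffPairs_image hg, ← Set.ncard_coe_finset]
    congr 1
    ext q
    simp only [Finset.bipartiteBelow, diffPairs, Finset.coe_filter, hmem, Set.mem_ofPred_eq]
    tauto
  rw [Finset.sum_congr rfl h1, Finset.sum_congr rfl h2, Finset.sum_const, Finset.sum_const,
    smul_eq_mul, smul_eq_mul, ← Set.ncard_eq_toFinset_card', ← Set.ncard_eq_toFinset_card'] at h
  exact h

/-- If the pairs of points of `B` are distributed over the orbits of the grid group
proportionally to the orbit sizes, then `B` generates a `2`-design. -/
theorem isDesign_blockOrbit (B : Set (∀ i, E i)) (k : ℕ) (hB : B.ncard = k) (hk : 2 ≤ k)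
    (hE : ∀ i, 1 < Fintype.card (E i))
    (hdiff : ∀ I : Finset (Fin s), I.Nonempty →
      (diffPairs B I).ncard = ∏ i ∈ I, (Fintype.card (E i) - 1)) :
    ∃ l : ℕ, IsDesign 2 (Fintype.card (∀ i, E i)) k l (blockOrbit B (gridGroup E)) := by
  classical
  set b := (blockOrbit B (gridGroup E)).ncard with hb
  set v := Fintype.card (∀ i, E i) with hv
  have hkv : k ≤ v := by
    rw [← hB, hv, ← Nat.card_eq_fintype_card, ← Set.ncard_univ]
    exact Set.ncard_le_ncard (Set.subset_univ _)
  have hlam : ∀ x y : ∀ i, E i, x ≠ y →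
      v * {C ∈ blockOrbit B (gridGroup E) | x ∈ C ∧ y ∈ C}.ncard = b := by
    intro x y hxy
    have hne : (diffSet x y).Nonempty := by
      obtain ⟨i, hi⟩ := Function.ne_iff.1 hxy
      exact ⟨i, by simpa [diffSet] using hi⟩
    have h := ncard_pairs_mul_blocks_through B x y
    rw [ncard_diffPairs_univ, hdiff _ hne] at h
    have hpos : 0 < ∏ i ∈ diffSet x y, (Fintype.card (E i) - 1) :=
      Finset.prod_pos fun i _ => Nat.sub_pos_of_lt (hE i)
    apply Nat.eq_of_mul_eq_mul_right hpos
    rw [← h]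
    ring
  have hbpos : 0 < b := (Set.ncard_pos (Set.toFinite _)).2 (isBlockTransitive_blockOrbit _ B).2.1
  have hvpos : 0 < v := by omega
  refine ⟨b / v, inferInstance, Nat.card_eq_fintype_card, hk, hkv, ?_, ?_, ?_⟩
  · have : 1 < Fintype.card (∀ i, E i) := by omega
    obtain ⟨x, y, hxy⟩ := Fintype.one_lt_card_iff.1 this
    have h := hlam x y hxy
    rw [← h, Nat.mul_div_cancel_left _ hvpos]
    rw [← h] at hbpos
    exact Nat.pos_of_mul_pos_left hbpos
  · rintro _ ⟨g, -, rfl⟩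
    rw [Set.ncard_image_of_injective _ g.injective, hB]
  · intro T hT
    obtain ⟨x, y, hxy, rfl⟩ := Set.ncard_eq_two.1 hT
    rw [← hlam x y hxy, Nat.mul_div_cancel_left _ hvpos]
    congr 1
    ext C
    simp [Set.insert_subset_iff]

end GridGroup

/-! ### Pairs of agreeing points in a set of natural number triples -/

/-- The set of triples `(x, y, 0)` with `(x, y) ∈ S₀`, together with the pairs
`(x, y, 2k - 1)`, `(x, y, 2k)` with `(x, y) ∈ S` and `k = k (x, y)`. -/
def layerSet (S₀ S : Finset (ℕ × ℕ)) (k : ℕ × ℕ → ℕ) : Finset (ℕ × ℕ × ℕ) :=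
  S₀.image (fun s => (s.1, s.2, 0)) ∪ (S.image (fun s => (s.1, s.2, 2 * k s - 1)) ∪
    S.image (fun s => (s.1, s.2, 2 * k s)))

theorem mem_layerSet {S₀ S : Finset (ℕ × ℕ)} {k : ℕ × ℕ → ℕ} {x : ℕ × ℕ × ℕ} :
    x ∈ layerSet S₀ S k ↔ (∃ s ∈ S₀, (s.1, s.2, 0) = x) ∨
      (∃ s ∈ S, (s.1, s.2, 2 * k s - 1) = x) ∨ ∃ s ∈ S, (s.1, s.2, 2 * k s) = x := by
  simp only [layerSet, Finset.mem_union, Finset.mem_image]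

section LayerSet

variable {S₀ S : Finset (ℕ × ℕ)} {k : ℕ × ℕ → ℕ}

theorem sum_layerSet (hpos : ∀ s ∈ S, 1 ≤ k s) (F : ℕ × ℕ × ℕ → ℕ) :
    ∑ x ∈ layerSet S₀ S k, F x = ∑ s ∈ S₀, F (s.1, s.2, 0) +
      ∑ s ∈ S, (F (s.1, s.2, 2 * k s - 1) + F (s.1, s.2, 2 * k s)) := by
  rw [layerSet, Finset.sum_union, Finset.sum_union, Finset.sum_image, Finset.sum_image,
    Finset.sum_image, Finset.sum_add_distrib]
  · exact fun s _ t _ h => Prod.ext (congrArg (·.1) h) (congrArg (·.2.1) h)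
  · exact fun s _ t _ h => Prod.ext (congrArg (·.1) h) (congrArg (·.2.1) h)
  · exact fun s _ t _ h => Prod.ext (congrArg (·.1) h) (congrArg (·.2.1) h)
  · rw [Finset.disjoint_left]
    simp only [Finset.mem_image, not_exists, not_and]
    rintro _ ⟨s, hs, rfl⟩ t ht h
    have h1 := hpos s hs
    simp only [Prod.mk.injEq] at h
    omega
  · rw [Finset.disjoint_left]
    simp only [Finset.mem_union, Finset.mem_image]
    rintro _ ⟨s, hs, rfl⟩ (⟨t, ht, h⟩ | ⟨t, ht, h⟩) <;>
    · have h1 := hpos t ht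
      simp only [Prod.mk.injEq] at h
      omega

theorem card_layerSet (hpos : ∀ s ∈ S, 1 ≤ k s) :
    (layerSet S₀ S k).card = S₀.card + 2 * S.card := by
  rw [Finset.card_eq_sum_ones, sum_layerSet hpos]
  simp [mul_comm]

theorem sum_sum_eq_eq_sum_sq {α β : Type*} [DecidableEq β] (Q : Finset α) (T : Finset β)
    (g : α → β) (hg : ∀ x ∈ Q, g x ∈ T) :
    (∑ x ∈ Q, ∑ y ∈ Q, if g x = g y then 1 else 0) =
      ∑ c ∈ T, (Q.filter fun x => g x = c).card ^ 2 := by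
  rw [← Finset.sum_fiberwise_of_maps_to hg]
  refine Finset.sum_congr rfl fun c _ => ?_
  rw [sq, ← smul_eq_mul, ← Finset.sum_const]
  refine Finset.sum_congr rfl fun x hx => ?_
  rw [Finset.card_filter]
  refine Finset.sum_congr rfl fun y _ => ?_
  rw [(Finset.mem_filter.1 hx).2]
  simp only [eq_comm]

/-- The pairs of triples whose cells agree under `f`, counted by the common value. -/
theorem sum_layerSet_cell_eq {β : Type*} [DecidableEq β] (hpos : ∀ s ∈ S, 1 ≤ k s)
    (f : ℕ → ℕ → β) (T : Finset β)
    (h₀ : ∀ s ∈ S₀, f s.1 s.2 ∈ T) (h : ∀ s ∈ S, f s.1 s.2 ∈ T) :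
    (∑ x ∈ layerSet S₀ S k, ∑ y ∈ layerSet S₀ S k,
      if f x.1 x.2.1 = f y.1 y.2.1 then 1 else 0) =
      ∑ c ∈ T, ((S₀.filter fun s => f s.1 s.2 = c).card +
        2 * (S.filter fun s => f s.1 s.2 = c).card) ^ 2 := by
  rw [sum_sum_eq_eq_sum_sq (layerSet S₀ S k) T (fun x => f x.1 x.2.1)]
  · refine Finset.sum_congr rfl fun c _ => ?_
    rw [Finset.card_filter, sum_layerSet hpos, Finset.card_filter, Finset.card_filter,
      Finset.mul_sum]
    simp only [two_mul]
  · intro x hx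
    rcases mem_layerSet.1 hx with ⟨s, hs, rfl⟩ | ⟨s, hs, rfl⟩ | ⟨s, hs, rfl⟩
    · exact h₀ s hs
    · exact h s hs
    · exact h s hs

theorem sum_layerSet_same_cell (hpos : ∀ s ∈ S, 1 ≤ k s)
    (hd : Disjoint S₀ S) :
    (∑ x ∈ layerSet S₀ S k, ∑ y ∈ layerSet S₀ S k,
      if (x.1, x.2.1) = (y.1, y.2.1) then 1 else 0) = S₀.card + 4 * S.card := by
  rw [sum_layerSet_cell_eq hpos Prod.mk (S₀ ∪ S)
    (fun s hs => Finset.mem_union_left _ hs) (fun s hs => Finset.mem_union_right _ hs),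
    Finset.sum_union hd]
  simp only [Prod.mk.eta, Finset.filter_eq']
  congr 1
  · rw [Finset.card_eq_sum_ones]
    refine Finset.sum_congr rfl fun s hs => ?_
    simp [hs, Finset.disjoint_left.1 hd hs]
  · rw [Finset.card_eq_sum_ones, Finset.mul_sum]
    refine Finset.sum_congr rfl fun s hs => ?_
    simp [hs, Finset.disjoint_right.1 hd hs]

/-- Two triples with the same third coordinate are equal unless that coordinate is `0`, so only the
cells in `S₀` contribute more than the diagonal pairs. -/
theorem sum_layerSet_same_layer (hpos : ∀ s ∈ S, 1 ≤ k s) (hk : Set.InjOn k S)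
    (R : ℕ × ℕ → ℕ × ℕ → Prop) [∀ s t, Decidable (R s t)] (hR : ∀ s, R s s) :
    (∑ x ∈ layerSet S₀ S k, ∑ y ∈ layerSet S₀ S k,
      if R (x.1, x.2.1) (y.1, y.2.1) ∧ x.2.2 = y.2.2 then 1 else 0) =
      (∑ s ∈ S₀, ∑ t ∈ S₀, if R s t then 1 else 0) + 2 * S.card := by
  rw [sum_layerSet hpos]
  simp only [sum_layerSet hpos, Prod.mk.eta]
  congr 1
  · refine Finset.sum_congr rfl fun s _ => ?_
    rw [Finset.sum_eq_zero (s := S)]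
    · simp
    · intro t ht
      have := hpos t ht
      rw [if_neg (by omega), if_neg (by omega), add_zero]
  · rw [mul_comm, ← smul_eq_mul, ← Finset.sum_const]
    refine Finset.sum_congr rfl fun s hs => ?_
    have hs1 := hpos s hs
    rw [Finset.sum_eq_zero, Finset.sum_eq_zero (s := S₀), Finset.sum_eq_single s,
      Finset.sum_eq_single s]
    · have h1 : ¬ (2 * k s - 1 = 2 * k s) := by omega
      have h2 : ¬ (2 * k s = 2 * k s - 1) := by omega
      simp [hR, h1, h2]
    · intro t ht hts
      have h1 := hpos t ht
      have h2 : k s ≠ k t := fun h => hts (hk ht hs h.symm)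
      rw [if_neg (by omega), if_neg (by omega), add_zero]
    · exact fun h => absurd hs h
    · intro t ht hts
      have h1 := hpos t ht
      have h2 : k s ≠ k t := fun h => hts (hk ht hs h.symm)
      rw [if_neg (by omega), if_neg (by omega), add_zero]
    · exact fun h => absurd hs h
    · intro t _
      rw [if_neg (by omega)]
    · intro t _
      rw [if_neg (by omega)]

end LayerSet

/-! ### From agreement counts to pair counts in the grid -/

/-- The numbers of ordered pairs of triples in `Q` that agree in the first, second, third
coordinate, or in two of them, are those of a set of `t + 1` points whose pairs are spread
evenly over the orbits of the group of an `e₁ × e₂ × e₃` grid. -/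
structure BalancedTriples (Q : Finset (ℕ × ℕ × ℕ)) (t e₁ e₂ e₃ : ℕ) : Prop where
  card : Q.card = t + 1
  agree₁ : (∑ x ∈ Q, ∑ y ∈ Q, if x.1 = y.1 then 1 else 0) = t + e₂ * e₃
  agree₂ : (∑ x ∈ Q, ∑ y ∈ Q, if x.2.1 = y.2.1 then 1 else 0) = t + e₁ * e₃
  agree₃ : (∑ x ∈ Q, ∑ y ∈ Q, if x.2.2 = y.2.2 then 1 else 0) = t + e₁ * e₂
  agree₁₂ : (∑ x ∈ Q, ∑ y ∈ Q, if x.1 = y.1 ∧ x.2.1 = y.2.1 then 1 else 0) = t + e₃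
  agree₁₃ : (∑ x ∈ Q, ∑ y ∈ Q, if x.1 = y.1 ∧ x.2.2 = y.2.2 then 1 else 0) = t + e₂
  agree₂₃ : (∑ x ∈ Q, ∑ y ∈ Q, if x.2.1 = y.2.1 ∧ x.2.2 = y.2.2 then 1 else 0) = t + e₁

/-- Inclusion-exclusion: the pairs that differ in exactly the coordinates singled out by
`P₁`, `P₂`, `P₃`. -/
theorem BalancedTriples.sum_pattern {Q : Finset (ℕ × ℕ × ℕ)} {t e₁ e₂ e₃ : ℕ}
    (h : BalancedTriples Q t e₁ e₂ e₃) (he : e₁ * e₂ * e₃ = t ^ 2 + t + 1)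
    (P₁ P₂ P₃ : Prop) [Decidable P₁] [Decidable P₂] [Decidable P₃] (hP : P₁ ∨ P₂ ∨ P₃) :
    (∑ x ∈ Q, ∑ y ∈ Q, if (P₁ ↔ x.1 ≠ y.1) ∧ (P₂ ↔ x.2.1 ≠ y.2.1) ∧ (P₃ ↔ x.2.2 ≠ y.2.2)
      then (1 : ℤ) else 0) = (if P₁ then (e₁ - 1 : ℤ) else 1) *
        (if P₂ then (e₂ - 1 : ℤ) else 1) * (if P₃ then (e₃ - 1 : ℤ) else 1) := by
  have he' : (e₁ * e₂ * e₃ : ℤ) = t ^ 2 + t + 1 := by exact_mod_cast he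
  have h0 : (∑ x ∈ Q, ∑ y ∈ Q, (1 : ℤ)) = (t + 1) ^ 2 := by
    simp [h.card]
    ring
  have h1 : (∑ x ∈ Q, ∑ y ∈ Q, if x.1 = y.1 then (1 : ℤ) else 0) = t + e₂ * e₃ := by
    exact_mod_cast h.agree₁
  have h2 : (∑ x ∈ Q, ∑ y ∈ Q, if x.2.1 = y.2.1 then (1 : ℤ) else 0) = t + e₁ * e₃ := by
    exact_mod_cast h.agree₂
  have h3 : (∑ x ∈ Q, ∑ y ∈ Q, if x.2.2 = y.2.2 then (1 : ℤ) else 0) = t + e₁ * e₂ := by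
    exact_mod_cast h.agree₃
  have h12 : (∑ x ∈ Q, ∑ y ∈ Q, if x.1 = y.1 ∧ x.2.1 = y.2.1 then (1 : ℤ) else 0) = t + e₃ := by
    exact_mod_cast h.agree₁₂
  have h13 : (∑ x ∈ Q, ∑ y ∈ Q, if x.1 = y.1 ∧ x.2.2 = y.2.2 then (1 : ℤ) else 0) = t + e₂ := by
    exact_mod_cast h.agree₁₃
  have h23 : (∑ x ∈ Q, ∑ y ∈ Q, if x.2.1 = y.2.1 ∧ x.2.2 = y.2.2 then (1 : ℤ) else 0) =
      t + e₁ := by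
    exact_mod_cast h.agree₂₃
  have h123 : (∑ x ∈ Q, ∑ y ∈ Q,
      if x.1 = y.1 ∧ x.2.1 = y.2.1 ∧ x.2.2 = y.2.2 then (1 : ℤ) else 0) = t + 1 := by
    have : ∀ x y : ℕ × ℕ × ℕ, (x.1 = y.1 ∧ x.2.1 = y.2.1 ∧ x.2.2 = y.2.2) ↔ x = y := by
      simp [Prod.ext_iff]
    simp [this, h.card]
  -- The indicator of the pattern is the product over the coordinates of `1 - a` or `a`, where `a`
  -- is the indicator of agreement: both have the form `c + d * a`.
  let c (P : Prop) [Decidable P] : ℤ := if P then 1 else 0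
  let d (P : Prop) [Decidable P] : ℤ := if P then -1 else 1
  have key : ∀ x y : ℕ × ℕ × ℕ,
      (if (P₁ ↔ x.1 ≠ y.1) ∧ (P₂ ↔ x.2.1 ≠ y.2.1) ∧ (P₃ ↔ x.2.2 ≠ y.2.2) then (1 : ℤ) else 0) =
      c P₁ * c P₂ * c P₃ * 1 + d P₁ * c P₂ * c P₃ * (if x.1 = y.1 then 1 else 0) +
      c P₁ * d P₂ * c P₃ * (if x.2.1 = y.2.1 then 1 else 0) +
      c P₁ * c P₂ * d P₃ * (if x.2.2 = y.2.2 then 1 else 0) +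
      d P₁ * d P₂ * c P₃ * (if x.1 = y.1 ∧ x.2.1 = y.2.1 then 1 else 0) +
      d P₁ * c P₂ * d P₃ * (if x.1 = y.1 ∧ x.2.2 = y.2.2 then 1 else 0) +
      c P₁ * d P₂ * d P₃ * (if x.2.1 = y.2.1 ∧ x.2.2 = y.2.2 then 1 else 0) +
      d P₁ * d P₂ * d P₃ *
        (if x.1 = y.1 ∧ x.2.1 = y.2.1 ∧ x.2.2 = y.2.2 then 1 else 0) := by
    intro x y
    by_cases a1 : x.1 = y.1 <;> by_cases a2 : x.2.1 = y.2.1 <;> by_cases a3 : x.2.2 = y.2.2 <;>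
      by_cases q1 : P₁ <;> by_cases q2 : P₂ <;> by_cases q3 : P₃ <;>
      simp [c, d, a1, a2, a3, q1, q2, q3]
  simp only [key, Finset.sum_add_distrib, ← Finset.mul_sum, h0, h1, h2, h3, h12, h13, h23, h123]
  by_cases q1 : P₁ <;> by_cases q2 : P₂ <;> by_cases q3 : P₃ <;>
    simp only [c, d, q1, q2, q3, if_true, if_false] <;> first | linarith | tauto

theorem gridPoint_apply_eq_iff {p : ℕ} {x y : ℕ × ℕ × ℕ}
    (hx : ∀ i, ![x.1, x.2.1, x.2.2] i < gridSize p i)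
    (hy : ∀ i, ![y.1, y.2.1, y.2.2] i < gridSize p i) (i : Fin 3) :
    gridPoint p x.1 x.2.1 x.2.2 i = gridPoint p y.1 y.2.1 y.2.2 i ↔
      ![x.1, x.2.1, x.2.2] i = ![y.1, y.2.1, y.2.2] i := by
  rw [gridPoint, gridPoint, ZMod.natCast_eq_natCast_iff']
  rw [Nat.mod_eq_of_lt (hx i), Nat.mod_eq_of_lt (hy i)]

theorem gridPoint_injOn {p : ℕ} {Q : Finset (ℕ × ℕ × ℕ)}
    (hQ : ∀ x ∈ Q, ∀ i, ![x.1, x.2.1, x.2.2] i < gridSize p i) :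
    Set.InjOn (fun x : ℕ × ℕ × ℕ => gridPoint p x.1 x.2.1 x.2.2) Q := by
  intro x hx y hy h
  have h' := fun i => (gridPoint_apply_eq_iff (hQ x hx) (hQ y hy) i).1 (congrFun h i)
  exact Prod.ext (h' 0) (Prod.ext (h' 1) (h' 2))

theorem BalancedTriples.ncard_diffPairs {p t : ℕ} {Q : Finset (ℕ × ℕ × ℕ)}
    (h : BalancedTriples Q t (gridSize p 0) (gridSize p 1) (gridSize p 2))
    (he : gridSize p 0 * gridSize p 1 * gridSize p 2 = t ^ 2 + t + 1)
    (hQ : ∀ x ∈ Q, ∀ i, ![x.1, x.2.1, x.2.2] i < gridSize p i)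
    (hpos : ∀ i, 0 < gridSize p i) (I : Finset (Fin 3)) (hI : I.Nonempty) :
    (diffPairs ((fun x : ℕ × ℕ × ℕ => gridPoint p x.1 x.2.1 x.2.2) '' Q) I).ncard =
      ∏ i ∈ I, (gridSize p i - 1) := by
  classical
  set f : ℕ × ℕ × ℕ → Grid p := fun x => gridPoint p x.1 x.2.1 x.2.2 with hf
  have hset : diffPairs (f '' Q) I = (fun q : (ℕ × ℕ × ℕ) × (ℕ × ℕ × ℕ) => (f q.1, f q.2)) ''
      ↑((Q ×ˢ Q).filter fun q => (0 ∈ I ↔ q.1.1 ≠ q.2.1) ∧ (1 ∈ I ↔ q.1.2.1 ≠ q.2.2.1) ∧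
        (2 ∈ I ↔ q.1.2.2 ≠ q.2.2.2)) := by
    have hd : ∀ x ∈ Q, ∀ y ∈ Q, diffSet (f x) (f y) = I ↔ (0 ∈ I ↔ x.1 ≠ y.1) ∧
        (1 ∈ I ↔ x.2.1 ≠ y.2.1) ∧ (2 ∈ I ↔ x.2.2 ≠ y.2.2) := by
      intro x hx y hy
      have := gridPoint_apply_eq_iff (hQ x hx) (hQ y hy)
      simp only [diffSet, Finset.ext_iff, Finset.mem_filter, Finset.mem_univ, true_and, hf, ne_eq,
        this, Fin.forall_iff_succ]
      simp
      tauto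
    ext ⟨a, b⟩
    constructor
    · rintro ⟨⟨x, hx, rfl⟩, ⟨y, hy, rfl⟩, hxy⟩
      refine ⟨(x, y), ?_, rfl⟩
      rw [Finset.mem_coe, Finset.mem_filter, Finset.mem_product]
      exact ⟨⟨hx, hy⟩, (hd x hx y hy).1 hxy⟩
    · rintro ⟨⟨x, y⟩, hxy, heq⟩
      obtain ⟨rfl, rfl⟩ := Prod.mk.inj heq
      rw [Finset.mem_coe, Finset.mem_filter, Finset.mem_product] at hxy
      obtain ⟨⟨hx, hy⟩, hxy⟩ := hxy
      exact ⟨⟨x, hx, rfl⟩, ⟨y, hy, rfl⟩, (hd x hx y hy).2 hxy⟩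
  rw [hset, Set.InjOn.ncard_image, Set.ncard_coe_finset, Finset.card_filter,
    Finset.sum_product]
  · have hP : 0 ∈ I ∨ 1 ∈ I ∨ 2 ∈ I := by
      obtain ⟨i, hi⟩ := hI
      fin_cases i <;> simp_all
    have hmain := h.sum_pattern he (0 ∈ I) (1 ∈ I) (2 ∈ I) hP
    have hcast : ((∏ i ∈ I, (gridSize p i - 1) : ℕ) : ℤ) =
        ∏ i : Fin 3, if i ∈ I then (gridSize p i - 1 : ℤ) else 1 := by
      rw [Finset.prod_ite_mem, Finset.univ_inter, Nat.cast_prod]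
      exact Finset.prod_congr rfl fun i _ => by rw [Nat.cast_sub (hpos i), Nat.cast_one]
    rw [Fin.prod_univ_three, ← hmain] at hcast
    exact_mod_cast hcast.symm
  · rintro ⟨x, y⟩ hxy ⟨x', y'⟩ hxy' heq
    rw [Finset.mem_coe, Finset.mem_filter, Finset.mem_product] at hxy hxy'
    obtain ⟨h1, h2⟩ := Prod.mk.inj heq
    exact Prod.ext (gridPoint_injOn hQ hxy.1.1 hxy'.1.1 h1)
      (gridPoint_injOn hQ hxy.1.2 hxy'.1.2 h2)

/-! ### Sets of triples described by two sets of cells -/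

/-- The conditions on row and column counts of two sets of cells under which the triples
arranged over them are balanced. -/
theorem balancedTriples_layerSet {S₀ S : Finset (ℕ × ℕ)} {k : ℕ × ℕ → ℕ} {t e₁ e₂ e₃ : ℕ}
    (hpos : ∀ s ∈ S, 1 ≤ k s) (hk : Set.InjOn k S) (hd : Disjoint S₀ S)
    (h₀ : ∀ s ∈ S₀, s.1 < e₁ ∧ s.2 < e₂) (h : ∀ s ∈ S, s.1 < e₁ ∧ s.2 < e₂)
    (hcard : S₀.card + 2 * S.card = t + 1) (hcell : S₀.card + 4 * S.card = t + e₃)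
    (hlayer : S₀.card ^ 2 + 2 * S.card = t + e₁ * e₂)
    (hcol₀ : ∑ c ∈ Finset.range e₁, (S₀.filter fun s => s.1 = c).card ^ 2 + 2 * S.card = t + e₂)
    (hrow₀ : ∑ c ∈ Finset.range e₂, (S₀.filter fun s => s.2 = c).card ^ 2 + 2 * S.card = t + e₁)
    (hcol : ∑ c ∈ Finset.range e₁, ((S₀.filter fun s => s.1 = c).card +
      2 * (S.filter fun s => s.1 = c).card) ^ 2 = t + e₂ * e₃)
    (hrow : ∑ c ∈ Finset.range e₂, ((S₀.filter fun s => s.2 = c).card +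
      2 * (S.filter fun s => s.2 = c).card) ^ 2 = t + e₁ * e₃) :
    BalancedTriples (layerSet S₀ S k) t e₁ e₂ e₃ := by
  refine ⟨?_, ?_, ?_, ?_, ?_, ?_, ?_⟩
  · rw [card_layerSet hpos, hcard]
  · rw [← hcol]
    exact sum_layerSet_cell_eq hpos (fun x _ => x) (Finset.range e₁)
      (fun s hs => Finset.mem_range.2 (h₀ s hs).1) (fun s hs => Finset.mem_range.2 (h s hs).1)
  · rw [← hrow]
    exact sum_layerSet_cell_eq hpos (fun _ y => y) (Finset.range e₂)
      (fun s hs => Finset.mem_range.2 (h₀ s hs).2) (fun s hs => Finset.mem_range.2 (h s hs).2)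
  · have := sum_layerSet_same_layer (S₀ := S₀) hpos hk (fun _ _ => True) (fun _ => trivial)
    simp only [true_and, if_true] at this
    rw [this, ← hlayer]
    simp [sq]
  · rw [← hcell, ← sum_layerSet_same_cell hpos hd]
    simp only [Prod.mk.injEq]
  · rw [sum_layerSet_same_layer hpos hk (fun s t => s.1 = t.1) (fun _ => rfl),
      sum_sum_eq_eq_sum_sq S₀ (Finset.range e₁) (fun s => s.1)
        (fun s hs => Finset.mem_range.2 (h₀ s hs).1), hcol₀]
  · rw [sum_layerSet_same_layer hpos hk (fun s t => s.2 = t.2) (fun _ => rfl),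
      sum_sum_eq_eq_sum_sq S₀ (Finset.range e₂) (fun s => s.2)
        (fun s hs => Finset.mem_range.2 (h₀ s hs).2), hrow₀]

theorem gridSize_zero (p : ℕ) : gridSize p 0 = p ^ 2 + p + 1 := rfl

theorem gridSize_one (p : ℕ) : gridSize p 1 = p ^ 2 - p + 1 := rfl

theorem gridSize_two (p : ℕ) : gridSize p 2 = p ^ 4 - p ^ 2 + 1 := rfl

theorem gridSize_prod (p : ℕ) (hp : 1 < p) :
    gridSize p 0 * gridSize p 1 * gridSize p 2 = (p ^ 4) ^ 2 + p ^ 4 + 1 := by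
  have h1 : p ≤ p ^ 2 := by nlinarith
  have h2 : p ^ 2 ≤ p ^ 4 := Nat.pow_le_pow_right (by omega) (by omega)
  rw [gridSize_zero, gridSize_one, gridSize_two]
  zify [h1, h2]
  ring

theorem one_lt_gridSize (p : ℕ) (hp : 1 < p) (i : Fin 3) : 1 < gridSize p i := by
  have h1 : p < p ^ 2 := by nlinarith
  have h2 : p ^ 2 < p ^ 4 := Nat.pow_lt_pow_right hp (by omega)
  fin_cases i
  · change 1 < p ^ 2 + p + 1
    omega
  · change 1 < p ^ 2 - p + 1
    omega
  · change 1 < p ^ 4 - p ^ 2 + 1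
    omega

/-- Balanced triples with entries below the side lengths of the grid keep their agreement pattern
when their entries are read as residue classes, so a base block given by them yields a design. -/
theorem isDesign_of_baseBlock_eq (p : ℕ) (hp : 1 < p) {Q : Finset (ℕ × ℕ × ℕ)}
    (hQ : BalancedTriples Q (p ^ 4) (gridSize p 0) (gridSize p 1) (gridSize p 2))
    (hlt : ∀ x ∈ Q, ∀ i, ![x.1, x.2.1, x.2.2] i < gridSize p i)
    (hB : baseBlock p = (fun x : ℕ × ℕ × ℕ => gridPoint p x.1 x.2.1 x.2.2) '' Q) :
    ∃ l : ℕ, IsDesign 2 (p ^ 8 + p ^ 4 + 1) (p ^ 4 + 1) l (designBlocks p) := by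
  classical
  have hpos : ∀ i, 0 < gridSize p i := fun i => (one_lt_gridSize p hp i).le
  have : ∀ i, NeZero (gridSize p i) := fun i => ⟨(hpos i).ne'⟩
  have hv : Fintype.card (Grid p) = p ^ 8 + p ^ 4 + 1 := by
    rw [Fintype.card_pi, Fin.prod_univ_three, ZMod.card, ZMod.card, ZMod.card,
      gridSize_prod p hp]
    ring
  have hk : (baseBlock p).ncard = p ^ 4 + 1 := by
    rw [hB, (gridPoint_injOn hlt).ncard_image, Set.ncard_coe_finset, hQ.card]
  rw [← hv]
  refine isDesign_blockOrbit (baseBlock p) _ hk ?_ ?_ ?_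
  · have : 0 < p ^ 4 := by positivity
    omega
  · intro i
    rw [ZMod.card]
    exact one_lt_gridSize p hp i
  · intro I hI
    rw [hB, hQ.ncard_diffPairs (gridSize_prod p hp) hlt hpos I hI]
    simp only [ZMod.card]

/-! ### The cells of the base block -/

/-- The cells under `B₁` and `B₂`, where `m = (p² - p) / 2`. The rows `2a - 1` and `2a` of column
`x = p + a` are written without subtraction. -/
def flatCells (p m : ℕ) : Finset (ℕ × ℕ) :=
  (Finset.range (p + m + p + m + 1) ×ˢ Finset.range (2 * m + 1)).filter fun s =>
    (s.1 ≤ p ∧ s.2 = 0) ∨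
      (p < s.1 ∧ s.1 ≤ p + m ∧ (s.2 + 1 + 2 * p = 2 * s.1 ∨ s.2 + 2 * p = 2 * s.1))

/-- Membership in the set of cells under `B₃` for `p > 2`, where `m = (p² - p) / 2` and `r` is the
number of rows of `B_{3,1}`. In column `p + a` of `B_{3,2}`, those of the rows `2a - 1` and `2a`
that are at most `m`, which the cells under `B₂` occupy, are shifted up by `m`. -/
def IsStackCell (p m r x y : ℕ) : Prop :=
  1 ≤ y ∧ y ≤ 2 * m ∧
    ((1 ≤ x ∧ x ≤ p ∧ y ≤ r) ∨
     (p < x ∧ x ≤ p + m ∧ y ≤ m ∧ ¬ (y + 1 + 2 * p = 2 * x ∨ y + 2 * p = 2 * x)) ∨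
     (p < x ∧ x ≤ p + m ∧ m < y ∧ (y + 1 + 2 * p = 2 * x + m ∨ y + 2 * p = 2 * x + m)) ∨
     (p + m < x ∧ x ≤ p + m + p ∧ r < y) ∨
     (x = p + m + p + 1 ∧ y ≤ m) ∨
     (p + m + p + 1 < x ∧ x ≤ p + m + p + m ∧ m < y))

instance (p m r x y : ℕ) : Decidable (IsStackCell p m r x y) := by
  unfold IsStackCell
  infer_instance

/-- The cells under `B₃` for `p > 2`. -/
def stackCells (p m r : ℕ) : Finset (ℕ × ℕ) :=
  (Finset.range (p + m + p + m + 1) ×ˢ Finset.range (2 * m + 1)).filter fun s =>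
    IsStackCell p m r s.1 s.2

theorem mem_stackCells {p m r : ℕ} {s : ℕ × ℕ} (hm : 1 ≤ m) :
    s ∈ stackCells p m r ↔ IsStackCell p m r s.1 s.2 := by
  simp only [stackCells, Finset.mem_filter, Finset.mem_product, Finset.mem_range]
  unfold IsStackCell
  omega

theorem card_filter_product_fst (a b c : ℕ) (hc : c < a) (P : ℕ × ℕ → Prop) [DecidablePred P] :
    (((Finset.range a ×ˢ Finset.range b).filter P).filter fun s => s.1 = c).card =
      ((Finset.range b).filter fun y => P (c, y)).card := by
  refine Finset.card_nbij' (fun s => s.2) (fun y => (c, y)) ?_ ?_ ?_ ?_ <;> intro s <;>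
    simp only [Finset.coe_filter, Finset.mem_filter, Finset.mem_product, Finset.mem_range,
      Set.mem_ofPred_eq]
  · rintro ⟨⟨⟨-, h⟩, hP⟩, rfl⟩
    exact ⟨h, hP⟩
  · exact fun h => ⟨⟨⟨hc, h.1⟩, h.2⟩, trivial⟩
  · rintro ⟨-, rfl⟩
    rfl
  · exact fun _ => trivial

theorem card_filter_product_snd (a b c : ℕ) (hc : c < b) (P : ℕ × ℕ → Prop) [DecidablePred P] :
    (((Finset.range a ×ˢ Finset.range b).filter P).filter fun s => s.2 = c).card =
      ((Finset.range a).filter fun x => P (x, c)).card := by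
  refine Finset.card_nbij' (fun s => s.1) (fun x => (x, c)) ?_ ?_ ?_ ?_ <;> intro s <;>
    simp only [Finset.coe_filter, Finset.mem_filter, Finset.mem_product, Finset.mem_range,
      Set.mem_ofPred_eq]
  · rintro ⟨⟨⟨h, -⟩, hP⟩, rfl⟩
    exact ⟨h, hP⟩
  · exact fun h => ⟨⟨⟨h.1, hc⟩, h.2⟩, trivial⟩
  · rintro ⟨-, rfl⟩
    rfl
  · exact fun _ => trivial

theorem flatCells_col_left {p m c : ℕ} (hc : c ≤ p) :
    ((flatCells p m).filter fun s => s.1 = c).card = 1 := by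
  rw [flatCells, card_filter_product_fst _ _ _ (by omega), Finset.card_eq_one]
  refine ⟨0, ?_⟩
  ext y
  simp only [Finset.mem_filter, Finset.mem_range, Finset.mem_singleton]
  omega

theorem flatCells_col_mid {p m c : ℕ} (hc : c < m) :
    ((flatCells p m).filter fun s => s.1 = p + 1 + c).card = 2 := by
  rw [flatCells, card_filter_product_fst _ _ _ (by omega), Finset.card_eq_two]
  refine ⟨2 * c + 1, 2 * c + 2, by omega, ?_⟩
  ext y
  simp only [Finset.mem_filter, Finset.mem_range, Finset.mem_insert, Finset.mem_singleton]
  omega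

theorem flatCells_col_right {p m c : ℕ} (hc : c < p + m) :
    ((flatCells p m).filter fun s => s.1 = p + 1 + m + c).card = 0 := by
  rw [flatCells, card_filter_product_fst _ _ _ (by omega), Finset.card_eq_zero]
  ext y
  simp only [Finset.mem_filter, Finset.mem_range, Finset.notMem_empty, iff_false]
  omega

theorem flatCells_row_zero {p m : ℕ} :
    ((flatCells p m).filter fun s => s.2 = 0).card = p + 1 := by
  rw [flatCells, card_filter_product_snd _ _ _ (by omega), ← Finset.card_range (p + 1)]
  congr 1
  ext y
  simp only [Finset.mem_filter, Finset.mem_range, and_true]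
  omega

theorem flatCells_row_pos {p m c : ℕ} (hc : c < 2 * m) :
    ((flatCells p m).filter fun s => s.2 = 1 + c).card = 1 := by
  rw [flatCells, card_filter_product_snd _ _ _ (by omega), Finset.card_eq_one]
  refine ⟨p + (c + 2) / 2, ?_⟩
  ext y
  simp only [Finset.mem_filter, Finset.mem_range, Finset.mem_singleton]
  omega

theorem stackCells_col_zero {p m r : ℕ} (hp : 1 ≤ p) :
    ((stackCells p m r).filter fun s => s.1 = 0).card = 0 := by
  rw [stackCells, card_filter_product_fst _ _ _ (by omega), Finset.card_eq_zero]
  ext y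
  simp only [Finset.mem_filter, Finset.mem_range, Finset.notMem_empty, iff_false]
  unfold IsStackCell
  omega

theorem stackCells_col_first {p m r c : ℕ} (hr : r ≤ 2 * m) (hc : c < p) :
    ((stackCells p m r).filter fun s => s.1 = 1 + c).card = r := by
  rw [stackCells, card_filter_product_fst _ _ _ (by omega)]
  trans (Finset.Ioc 0 r).card
  · congr 1
    ext y
    simp only [Finset.mem_filter, Finset.mem_range, Finset.mem_Ioc]
    unfold IsStackCell
    omega
  · simp

/-- The shift by `m` moves cells of `B_{3,2}` within their column to free rows, so that the column
still has `m` cells. -/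
theorem stackCells_col_second {p m r c : ℕ} (hm : 2 ≤ m) (hc : c < m) :
    ((stackCells p m r).filter fun s => s.1 = 1 + p + c).card = m := by
  rw [stackCells, card_filter_product_fst _ _ _ (by omega)]
  trans (Finset.Ioc 0 m).card
  · refine Finset.card_nbij' (fun y => if y ≤ m then y else y - m)
      (fun y => if y = 2 * c + 1 ∨ y = 2 * c + 2 then y + m else y) ?_ ?_ ?_ ?_ <;> intro y <;>
      simp only [Finset.coe_filter, Finset.mem_range, Finset.coe_Ioc, Set.mem_Ioc,
        Set.mem_ofPred_eq] <;>
      (try unfold IsStackCell) <;> intro h <;> split_ifs <;> omega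
  · simp

theorem stackCells_col_third {p m r c : ℕ} (hc : c < p) :
    ((stackCells p m r).filter fun s => s.1 = 1 + p + m + c).card = 2 * m - r := by
  rw [stackCells, card_filter_product_fst _ _ _ (by omega)]
  trans (Finset.Ioc r (2 * m)).card
  · congr 1
    ext y
    simp only [Finset.mem_filter, Finset.mem_range, Finset.mem_Ioc]
    unfold IsStackCell
    omega
  · simp

theorem stackCells_col_fourth {p m r c : ℕ} (hc : c < m) :
    ((stackCells p m r).filter fun s => s.1 = 1 + p + m + p + c).card = m := by
  rw [stackCells, card_filter_product_fst _ _ _ (by omega)]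
  by_cases h0 : c = 0
  · trans (Finset.Ioc 0 m).card
    · congr 1
      ext y
      simp only [Finset.mem_filter, Finset.mem_range, Finset.mem_Ioc]
      unfold IsStackCell
      omega
    · simp
  · trans (Finset.Ioc m (2 * m)).card
    · congr 1
      ext y
      simp only [Finset.mem_filter, Finset.mem_range, Finset.mem_Ioc]
      unfold IsStackCell
      omega
    · simp only [Nat.card_Ioc]
      omega

theorem stackCells_row_zero {p m r : ℕ} :
    ((stackCells p m r).filter fun s => s.2 = 0).card = 0 := by
  rw [stackCells, card_filter_product_snd _ _ _ (by omega), Finset.card_eq_zero]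
  ext y
  simp only [Finset.mem_filter, Finset.mem_range, Finset.notMem_empty, iff_false]
  unfold IsStackCell
  omega

/-- A lower row misses one column of `B_{3,2}`, the one whose cell is shifted up, and gains the
first column of `B_{3,4}`; an upper row has just one column of `B_{3,2}` and all but the first of
`B_{3,4}`. -/
theorem stackCells_row_pos {p m r c : ℕ} (hm : 2 ≤ m) (hc : c < 2 * m) :
    ((stackCells p m r).filter fun s => s.2 = 1 + c).card = p + m := by
  rw [stackCells, card_filter_product_snd _ _ _ (by omega)]
  -- The columns of the blocks `B_{3,1}` and `B_{3,3}` that meet the row.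
  set F : Finset ℕ := if c < r then Finset.Ioc 0 p else Finset.Ioc (p + m) (p + m + p) with hF
  have hFcard : F.card = p := by
    rw [hF]
    split_ifs <;> simp
  by_cases h : c < m
  · trans (F ∪ ((Finset.Ioc p (p + m)).erase (p + (c + 2) / 2) ∪ {p + m + p + 1})).card
    · congr 1
      ext x
      by_cases hr : c < r <;>
      · simp only [hF, hr, if_true, if_false, Finset.mem_filter, Finset.mem_range,
          Finset.mem_union, Finset.mem_erase, Finset.mem_Ioc, Finset.mem_singleton]
        unfold IsStackCell
        omega
    · rw [Finset.card_union_of_disjoint, Finset.card_union_of_disjoint,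
        Finset.card_erase_of_mem, hFcard, Nat.card_Ioc, Finset.card_singleton]
      · omega
      · rw [Finset.mem_Ioc]
        omega
      · rw [Finset.disjoint_left]
        intro x
        simp only [Finset.mem_erase, Finset.mem_Ioc, Finset.mem_singleton]
        omega
      · rw [Finset.disjoint_left]
        intro x
        by_cases hr : c < r <;>
        · simp only [hF, hr, if_true, if_false, Finset.mem_union, Finset.mem_erase,
            Finset.mem_Ioc, Finset.mem_singleton]
          omega
  · trans (F ∪ ({p + (c - m + 2) / 2} ∪ Finset.Ioc (p + m + p + 1) (p + m + p + m))).card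
    · congr 1
      ext x
      by_cases hr : c < r <;>
      · simp only [hF, hr, if_true, if_false, Finset.mem_filter, Finset.mem_range,
          Finset.mem_union, Finset.mem_Ioc, Finset.mem_singleton]
        unfold IsStackCell
        omega
    · rw [Finset.card_union_of_disjoint, Finset.card_union_of_disjoint, hFcard, Nat.card_Ioc,
        Finset.card_singleton]
      · omega
      · rw [Finset.disjoint_left]
        intro x
        simp only [Finset.mem_Ioc, Finset.mem_singleton]
        omega
      · rw [Finset.disjoint_left]
        intro x
        by_cases hr : c < r <;>
        · simp only [hF, hr, if_true, if_false, Finset.mem_union, Finset.mem_Ioc,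
            Finset.mem_singleton]
          omega

/-! ### Counting the cells -/

theorem card_eq_sum_rows {T : Finset (ℕ × ℕ)} {e : ℕ} (h : ∀ s ∈ T, s.2 < e) :
    T.card = ∑ c ∈ Finset.range e, (T.filter fun s => s.2 = c).card :=
  Finset.card_eq_sum_card_fiberwise fun s hs => Finset.mem_coe.2 (Finset.mem_range.2 (h s hs))

theorem sum_range_split_const {f : ℕ → ℕ} {n₁ n₂ n₃ n₄ a₀ a₁ a₂ a₃ a₄ : ℕ} (h₀ : f 0 = a₀)
    (h₁ : ∀ c < n₁, f (1 + c) = a₁) (h₂ : ∀ c < n₂, f (1 + n₁ + c) = a₂)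
    (h₃ : ∀ c < n₃, f (1 + n₁ + n₂ + c) = a₃) (h₄ : ∀ c < n₄, f (1 + n₁ + n₂ + n₃ + c) = a₄) :
    ∑ c ∈ Finset.range (1 + n₁ + n₂ + n₃ + n₄), f c =
      a₀ + n₁ * a₁ + n₂ * a₂ + n₃ * a₃ + n₄ * a₄ := by
  rw [Finset.sum_range_add, Finset.sum_range_add, Finset.sum_range_add, Finset.sum_range_add,
    Finset.sum_range_one, h₀, Finset.sum_congr rfl fun c hc => h₁ c (Finset.mem_range.1 hc),
    Finset.sum_congr rfl fun c hc => h₂ c (Finset.mem_range.1 hc),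
    Finset.sum_congr rfl fun c hc => h₃ c (Finset.mem_range.1 hc),
    Finset.sum_congr rfl fun c hc => h₄ c (Finset.mem_range.1 hc)]
  simp

theorem flatCells_bound {p m : ℕ} :
    ∀ s ∈ flatCells p m, s.1 < 1 + p + m + p + m ∧ s.2 < 1 + 2 * m := by
  intro s hs
  simp only [flatCells, Finset.mem_filter, Finset.mem_product, Finset.mem_range] at hs
  omega

theorem stackCells_bound {p m r : ℕ} :
    ∀ s ∈ stackCells p m r, s.1 < 1 + p + m + p + m ∧ s.2 < 1 + 2 * m := by
  intro s hs
  simp only [stackCells, Finset.mem_filter, Finset.mem_product, Finset.mem_range] at hs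
  omega

theorem sum_range_one_add_const {f : ℕ → ℕ} {n a₀ a₁ : ℕ} (h₀ : f 0 = a₀)
    (h₁ : ∀ c < n, f (1 + c) = a₁) : ∑ c ∈ Finset.range (1 + n), f c = a₀ + n * a₁ := by
  rw [Finset.sum_range_add, Finset.sum_range_one, h₀,
    Finset.sum_congr rfl fun c hc => h₁ c (Finset.mem_range.1 hc)]
  simp

theorem card_flatCells {p m : ℕ} : (flatCells p m).card = p + 1 + 2 * m := by
  rw [card_eq_sum_rows fun s hs => (flatCells_bound s hs).2,
    sum_range_one_add_const flatCells_row_zero fun c hc => flatCells_row_pos hc, mul_one]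

theorem card_stackCells {p m r : ℕ} (hm : 2 ≤ m) :
    (stackCells p m r).card = 2 * m * (p + m) := by
  rw [card_eq_sum_rows fun s hs => (stackCells_bound s hs).2,
    sum_range_one_add_const stackCells_row_zero fun c hc => stackCells_row_pos hm hc, zero_add]

theorem sum_sq_flatCells_col {p m : ℕ} :
    ∑ c ∈ Finset.range (1 + p + m + p + m), ((flatCells p m).filter fun s => s.1 = c).card ^ 2 =
      1 + p + 4 * m := by
  rw [sum_range_split_const (f := fun c => ((flatCells p m).filter fun s => s.1 = c).card ^ 2)
    (n₁ := p) (n₂ := m) (n₃ := p) (n₄ := m) (a₀ := 1) (a₁ := 1) (a₂ := 4) (a₃ := 0) (a₄ := 0)]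
  · ring
  · rw [flatCells_col_left (Nat.zero_le _), one_pow]
  · intro c hc
    rw [flatCells_col_left (by omega), one_pow]
  · intro c hc
    rw [show 1 + p + c = p + 1 + c by omega, flatCells_col_mid hc]
    rfl
  · intro c hc
    rw [show 1 + p + m + c = p + 1 + m + c by omega, flatCells_col_right (by omega)]
    rfl
  · intro c hc
    rw [show 1 + p + m + p + c = p + 1 + m + (p + c) by omega, flatCells_col_right (by omega)]
    rfl

theorem sum_sq_flatCells_row {p m : ℕ} :
    ∑ c ∈ Finset.range (1 + 2 * m), ((flatCells p m).filter fun s => s.2 = c).card ^ 2 =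
      (p + 1) ^ 2 + 2 * m := by
  rw [sum_range_one_add_const (a₀ := (p + 1) ^ 2) (a₁ := 1), mul_one]
  · rw [flatCells_row_zero]
  · intro c hc
    rw [flatCells_row_pos hc, one_pow]

theorem sum_sq_cells_col {p m r : ℕ} (hp : 1 ≤ p) (hm : 2 ≤ m) (hr : r ≤ 2 * m) :
    ∑ c ∈ Finset.range (1 + p + m + p + m), (((flatCells p m).filter fun s => s.1 = c).card +
        2 * ((stackCells p m r).filter fun s => s.1 = c).card) ^ 2 =
      1 + p * (1 + 2 * r) ^ 2 + m * (2 + 2 * m) ^ 2 + p * (2 * (2 * m - r)) ^ 2 +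
        m * (2 * m) ^ 2 := by
  apply sum_range_split_const
  · rw [flatCells_col_left (Nat.zero_le _), stackCells_col_zero hp]
    rfl
  · intro c hc
    rw [flatCells_col_left (by omega), stackCells_col_first hr hc]
  · intro c hc
    rw [stackCells_col_second hm hc, show 1 + p + c = p + 1 + c by omega, flatCells_col_mid hc]
  · intro c hc
    rw [stackCells_col_third hc, show 1 + p + m + c = p + 1 + m + c by omega,
      flatCells_col_right (by omega), zero_add]
  · intro c hc
    rw [stackCells_col_fourth hc, show 1 + p + m + p + c = p + 1 + m + (p + c) by omega,
      flatCells_col_right (by omega), zero_add]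

theorem sum_sq_cells_row {p m r : ℕ} (hm : 2 ≤ m) :
    ∑ c ∈ Finset.range (1 + 2 * m), (((flatCells p m).filter fun s => s.2 = c).card +
        2 * ((stackCells p m r).filter fun s => s.2 = c).card) ^ 2 =
      (p + 1) ^ 2 + 2 * m * (1 + 2 * (p + m)) ^ 2 := by
  apply sum_range_one_add_const
  · rw [flatCells_row_zero, stackCells_row_zero]
  · intro c hc
    rw [flatCells_row_pos hc, stackCells_row_pos hm hc]

theorem disjoint_flatCells_stackCells {p m r : ℕ} (hm : 2 ≤ m) :
    Disjoint (flatCells p m) (stackCells p m r) := by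
  rw [Finset.disjoint_left]
  intro s h₀ h
  rw [mem_stackCells (by omega)] at h
  unfold IsStackCell at h
  simp only [flatCells, Finset.mem_filter, Finset.mem_product, Finset.mem_range] at h₀
  omega

/-- For both admissible values of the number `r` of rows of `B_{3,1}`, which arise for odd and
even `p`, the triples over the cells are balanced. -/
theorem balancedTriples_cells {p m r : ℕ} {k : ℕ × ℕ → ℕ} (hp : 1 ≤ p) (hm : 2 ≤ m)
    (hpm : 2 * m + p = p ^ 2) (hr : 2 * r + 1 = p ^ 2 ∨ 2 * r + 2 * p = p ^ 2)
    (hpos : ∀ s ∈ stackCells p m r, 1 ≤ k s) (hk : Set.InjOn k (stackCells p m r)) :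
    BalancedTriples (layerSet (flatCells p m) (stackCells p m r) k) (p ^ 4)
      (gridSize p 0) (gridSize p 1) (gridSize p 2) := by
  have hr' : r ≤ 2 * m := by
    rcases hr with hr | hr
    · have : p ≤ m + m := by nlinarith
      omega
    · omega
  have hmQ : (m : ℚ) = ((p : ℚ) ^ 2 - p) / 2 := by
    have : (2 * m + p : ℚ) = p ^ 2 := by exact_mod_cast hpm
    linarith
  have h24 : p ^ 2 ≤ p ^ 4 := Nat.pow_le_pow_right hp (by omega)
  have e1 : gridSize p 0 = 1 + p + m + p + m := by
    rw [gridSize_zero]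
    omega
  have e2 : gridSize p 1 = 1 + 2 * m := by
    rw [gridSize_one]
    omega
  have e3 : (gridSize p 2 : ℚ) = (p : ℚ) ^ 4 - p ^ 2 + 1 := by
    rw [gridSize_two, Nat.cast_add, Nat.cast_sub h24]
    push_cast
    ring
  generalize gridSize p 2 = e₃ at e3
  rw [e1, e2]
  apply balancedTriples_layerSet hpos hk (disjoint_flatCells_stackCells hm) flatCells_bound
    stackCells_bound
  · rw [card_flatCells, card_stackCells hm]
    qify
    rw [hmQ]
    ring
  · rw [card_flatCells, card_stackCells hm]
    qify
    rw [hmQ, e3]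
    ring
  · rw [card_flatCells, card_stackCells hm]
    qify
    rw [hmQ]
    ring
  · rw [sum_sq_flatCells_col, card_stackCells hm]
    qify
    rw [hmQ]
    ring
  · rw [sum_sq_flatCells_row, card_stackCells hm]
    qify
    rw [hmQ]
    ring
  · rw [sum_sq_cells_col hp hm hr']
    qify [hr']
    rw [hmQ, e3]
    rcases hr with hr | hr
    · have hrQ : (r : ℚ) = ((p : ℚ) ^ 2 - 1) / 2 := by
        have : (2 * r + 1 : ℚ) = p ^ 2 := by exact_mod_cast hr
        linarith
      rw [hrQ]
      ring
    · have hrQ : (r : ℚ) = ((p : ℚ) ^ 2 - 2 * p) / 2 := by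
        have : (2 * r + 2 * p : ℚ) = p ^ 2 := by exact_mod_cast hr
        linarith
      rw [hrQ]
      ring
  · rw [sum_sq_cells_row hm]
    qify
    rw [hmQ, e3]
    ring

/-! ### The enumeration of the layers -/

/-- The cell `(x, y)` under `B₃` carries the two points of `B` in the layers `2k - 1` and `2k`,
where `k` is `stackIndex p m r (x, y)`. -/
def stackIndex (p m r : ℕ) (s : ℕ × ℕ) : ℕ :=
  if s.1 ≤ p then s.1 + (s.2 - 1) * p
  else if s.1 ≤ p + m then
    p * r + (s.1 - p + ((if s.2 ≤ m then s.2 else s.2 - m) - 1) * m)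
  else if s.1 ≤ p + m + p then p * r + m * m + (s.1 - (p + m) + (s.2 - r - 1) * p)
  else p * r + m * m + p * (2 * m - r) +
    (s.1 - (p + m + p) + ((if s.2 ≤ m then s.2 else s.2 - m) - 1) * m)

theorem array_index_bounds {a b m n : ℕ} (ha : 1 ≤ a) (ham : a ≤ m) (hb : 1 ≤ b) (hbn : b ≤ n) :
    1 ≤ a + (b - 1) * m ∧ a + (b - 1) * m ≤ m * n := by
  obtain ⟨b, rfl⟩ := Nat.exists_eq_add_of_le hb
  rw [Nat.add_sub_cancel_left]
  exact ⟨by omega, by nlinarith [Nat.mul_le_mul_left m hbn]⟩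

theorem array_index_injective {a b a' b' m : ℕ} (ha : 1 ≤ a) (ham : a ≤ m) (hb : 1 ≤ b)
    (ha' : 1 ≤ a') (ham' : a' ≤ m) (hb' : 1 ≤ b')
    (h : a + (b - 1) * m = a' + (b' - 1) * m) : a = a' ∧ b = b' := by
  have hlt : ∀ {a b a' b' : ℕ}, 1 ≤ a → a' ≤ m → a + b * m = a' + b' * m → b ≤ b' := by
    intro a b a' b' ha ha' h
    by_contra! hb
    nlinarith [Nat.mul_le_mul_right m hb]
  have hbb : b - 1 = b' - 1 := le_antisymm (hlt ha ham' h) (hlt ha' ham h.symm)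
  rw [hbb] at h
  omega

/-- A cell under `B₃` lies in one of the four arrays, and its index is computed from its position
`(a, b)` there. -/
theorem stackCell_cases {p m r : ℕ} {s : ℕ × ℕ} (hr : r ≤ 2 * m) (hs : IsStackCell p m r s.1 s.2) :
    ∃ a b, 1 ≤ a ∧ 1 ≤ b ∧
    ((a ≤ p ∧ b ≤ r ∧ s = (a, b) ∧ stackIndex p m r s = a + (b - 1) * p) ∨
     (a ≤ m ∧ b ≤ m ∧
        s = (p + a, b + if a ≤ (m + 1) / 2 ∧ (b = 2 * a - 1 ∨ b = 2 * a) then m else 0) ∧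
        stackIndex p m r s = p * r + (a + (b - 1) * m)) ∨
     (a ≤ p ∧ b ≤ 2 * m - r ∧ s = (p + m + a, r + b) ∧
        stackIndex p m r s = p * r + m * m + (a + (b - 1) * p)) ∨
     (a ≤ m ∧ b ≤ m ∧ s = (p + m + p + a, b + if a = 1 then 0 else m) ∧
        stackIndex p m r s = p * r + m * m + p * (2 * m - r) + (a + (b - 1) * m))) := by
  obtain ⟨x, y⟩ := s
  unfold IsStackCell at hs
  dsimp only at hs
  by_cases h1 : x ≤ p
  · refine ⟨x, y, by omega, by omega, Or.inl ⟨by omega, by omega, rfl, ?_⟩⟩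
    rw [stackIndex, if_pos h1]
  by_cases h2 : x ≤ p + m
  · refine ⟨x - p, if y ≤ m then y else y - m, by omega, by split_ifs <;> omega,
      Or.inr (Or.inl ⟨by omega, by split_ifs <;> omega, ?_, ?_⟩)⟩
    · rw [Prod.mk.injEq]
      refine ⟨by omega, ?_⟩
      split_ifs <;> omega
    · rw [stackIndex, if_neg h1, if_pos h2]
  by_cases h3 : x ≤ p + m + p
  · refine ⟨x - (p + m), y - r, by omega, by omega,
      Or.inr (Or.inr (Or.inl ⟨by omega, by omega, ?_, ?_⟩))⟩
    · rw [Prod.mk.injEq]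
      omega
    · rw [stackIndex, if_neg h1, if_neg h2, if_pos h3]
  · refine ⟨x - (p + m + p), if y ≤ m then y else y - m, by omega, by split_ifs <;> omega,
      Or.inr (Or.inr (Or.inr ⟨by omega, by split_ifs <;> omega, ?_, ?_⟩))⟩
    · rw [Prod.mk.injEq]
      refine ⟨by omega, ?_⟩
      split_ifs <;> omega
    · rw [stackIndex, if_neg h1, if_neg h2, if_neg h3]

theorem stackIndex_bounds {p m r : ℕ} {s : ℕ × ℕ} (hr : r ≤ 2 * m)
    (hs : IsStackCell p m r s.1 s.2) :
    1 ≤ stackIndex p m r s ∧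
      stackIndex p m r s ≤ p * r + m * m + p * (2 * m - r) + m * m := by
  obtain ⟨a, b, ha, hb, ⟨ha', hb', -, h⟩ | ⟨ha', hb', -, h⟩ | ⟨ha', hb', -, h⟩ |
    ⟨ha', hb', -, h⟩⟩ := stackCell_cases hr hs <;>
  · have := array_index_bounds ha ha' hb hb'
    omega

theorem stackIndex_injOn {p m r : ℕ} (hm : 1 ≤ m) (hr : r ≤ 2 * m) :
    Set.InjOn (stackIndex p m r) (stackCells p m r) := by
  intro s hs t ht hst
  rw [Finset.mem_coe, mem_stackCells hm] at hs ht
  obtain ⟨a, b, ha, hb, ⟨ha', hb', hs', h⟩ | ⟨ha', hb', hs', h⟩ | ⟨ha', hb', hs', h⟩ |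
    ⟨ha', hb', hs', h⟩⟩ := stackCell_cases hr hs <;>
  obtain ⟨c, d, hc, hd, ⟨hc', hd', ht', k⟩ | ⟨hc', hd', ht', k⟩ | ⟨hc', hd', ht', k⟩ |
    ⟨hc', hd', ht', k⟩⟩ := stackCell_cases hr ht <;>
  have h1 := array_index_bounds ha ha' hb hb' <;>
  have h2 := array_index_bounds hc hc' hd hd' <;>
  first
  | (exfalso; omega)
  | (obtain ⟨rfl, rfl⟩ := array_index_injective ha ha' hb hc hc' hd (by omega)
     rw [hs', ht'])

theorem isStackCell_first {p m r a b : ℕ} (hr : r ≤ 2 * m) (ha : 1 ≤ a) (hap : a ≤ p)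
    (hb : 1 ≤ b) (hbr : b ≤ r) :
    IsStackCell p m r a b ∧ stackIndex p m r (a, b) = a + (b - 1) * p := by
  refine ⟨?_, by rw [stackIndex, if_pos hap]⟩
  unfold IsStackCell
  omega

theorem isStackCell_second {p m r a b y : ℕ} (hm : 2 ≤ m) (ha : 1 ≤ a) (ham : a ≤ m)
    (hb : 1 ≤ b) (hbm : b ≤ m)
    (hy : y = b + if a ≤ (m + 1) / 2 ∧ (b = 2 * a - 1 ∨ b = 2 * a) then m else 0) :
    IsStackCell p m r (p + a) y ∧
      stackIndex p m r (p + a, y) = p * r + (a + (b - 1) * m) := by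
  constructor
  · unfold IsStackCell
    split_ifs at hy <;> omega
  · have h : (if y ≤ m then y else y - m) = b := by
      split_ifs at hy ⊢ <;> omega
    simp only [stackIndex]
    rw [if_neg (by omega), if_pos (by omega), h, Nat.add_sub_cancel_left]

theorem isStackCell_third {p m r a b : ℕ} (ha : 1 ≤ a) (hap : a ≤ p)
    (hb : 1 ≤ b) (hbr : b ≤ 2 * m - r) :
    IsStackCell p m r (p + m + a) (r + b) ∧
      stackIndex p m r (p + m + a, r + b) = p * r + m * m + (a + (b - 1) * p) := by
  constructor
  · unfold IsStackCell
    omega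
  · simp only [stackIndex]
    rw [if_neg (by omega), if_neg (by omega), if_pos (by omega), Nat.add_sub_cancel_left,
      Nat.add_sub_cancel_left]

theorem isStackCell_fourth {p m r a b y : ℕ} (ha : 1 ≤ a) (ham : a ≤ m)
    (hb : 1 ≤ b) (hbm : b ≤ m) (hy : y = b + if a = 1 then 0 else m) :
    IsStackCell p m r (p + m + p + a) y ∧ stackIndex p m r (p + m + p + a, y) =
      p * r + m * m + p * (2 * m - r) + (a + (b - 1) * m) := by
  constructor
  · unfold IsStackCell
    split_ifs at hy <;> omega
  · have h : (if y ≤ m then y else y - m) = b := by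
      split_ifs at hy ⊢ <;> omega
    simp only [stackIndex]
    rw [if_neg (by omega), if_neg (by omega), if_neg (by omega), h, Nat.add_sub_cancel_left]

/-! ### The base block in terms of its cells -/

theorem image_layerSet (p : ℕ) (S₀ S : Finset (ℕ × ℕ)) (k : ℕ × ℕ → ℕ) :
    (fun x : ℕ × ℕ × ℕ => gridPoint p x.1 x.2.1 x.2.2) '' layerSet S₀ S k =
      {x | ∃ s ∈ S₀, x = gridPoint p s.1 s.2 0} ∪
        {x | ∃ s ∈ S, x ∈ layerPair p s.1 s.2 (2 * k s)} := by
  ext x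
  simp only [Set.mem_image, Finset.mem_coe, mem_layerSet, Set.mem_union, Set.mem_ofPred_eq,
    layerPair, Set.mem_insert_iff, Set.mem_singleton_iff]
  constructor
  · rintro ⟨_, ⟨s, hs, rfl⟩ | ⟨s, hs, rfl⟩ | ⟨s, hs, rfl⟩, rfl⟩
    · exact Or.inl ⟨s, hs, rfl⟩
    · exact Or.inr ⟨s, hs, Or.inl rfl⟩
    · exact Or.inr ⟨s, hs, Or.inr rfl⟩
  · rintro (⟨s, hs, rfl⟩ | ⟨s, hs, rfl | rfl⟩)
    · exact ⟨_, Or.inl ⟨s, hs, rfl⟩, rfl⟩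
    · exact ⟨_, Or.inr (Or.inl ⟨s, hs, rfl⟩), rfl⟩
    · exact ⟨_, Or.inr (Or.inr ⟨s, hs, rfl⟩), rfl⟩

theorem layerSet_lt_gridSize {p : ℕ} {S₀ S : Finset (ℕ × ℕ)} {k : ℕ × ℕ → ℕ}
    (h₀ : ∀ s ∈ S₀, s.1 < gridSize p 0 ∧ s.2 < gridSize p 1)
    (h : ∀ s ∈ S, s.1 < gridSize p 0 ∧ s.2 < gridSize p 1)
    (hk : ∀ s ∈ S, 2 * k s < gridSize p 2) :
    ∀ x ∈ layerSet S₀ S k, ∀ i, ![x.1, x.2.1, x.2.2] i < gridSize p i := by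
  intro x hx
  rw [Fin.forall_fin_succ, Fin.forall_fin_two]
  change x.1 < gridSize p 0 ∧ x.2.1 < gridSize p 1 ∧ x.2.2 < gridSize p 2
  rcases mem_layerSet.1 hx with ⟨s, hs, rfl⟩ | ⟨s, hs, rfl⟩ | ⟨s, hs, rfl⟩
  · exact ⟨(h₀ s hs).1, (h₀ s hs).2, Nat.succ_pos _⟩
  · exact ⟨(h s hs).1, (h s hs).2, (Nat.sub_le _ _).trans_lt (hk s hs)⟩
  · exact ⟨(h s hs).1, (h s hs).2, hk s hs⟩

theorem flatCells_points_eq {p m : ℕ} (hpm : (p ^ 2 - p) / 2 = m) :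
    {x | ∃ s ∈ flatCells p m, x = gridPoint p s.1 s.2 0} = block1 p ∪ block2 p := by
  subst hpm
  ext x
  simp only [block1, block2, flatCells, Set.mem_union, Set.mem_ofPred_eq, Finset.mem_filter,
    Finset.mem_product, Finset.mem_range]
  constructor
  · rintro ⟨⟨a, b⟩, ⟨-, ⟨ha, hb⟩ | ⟨ha, ha', hb | hb⟩⟩, rfl⟩ <;> dsimp only at ha hb ⊢
    · exact Or.inl ⟨a, ha, by rw [hb]⟩
    · refine Or.inr ⟨a - p, by omega, by omega, Or.inl ?_⟩
      rw [show p + (a - p) = a by omega, show 2 * (a - p) - 1 = b by omega]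
    · refine Or.inr ⟨a - p, by omega, by omega, Or.inr ?_⟩
      rw [show p + (a - p) = a by omega, show 2 * (a - p) = b by omega]
  · rintro (⟨a, ha, rfl⟩ | ⟨a, ha, ha', rfl | rfl⟩)
    · exact ⟨(a, 0), ⟨by dsimp only; omega, Or.inl ⟨ha, rfl⟩⟩, rfl⟩
    · exact ⟨(p + a, 2 * a - 1), by dsimp only; omega, rfl⟩
    · exact ⟨(p + a, 2 * a), by dsimp only; omega, rfl⟩

/-- The union of the four arrays of `B₃` for `p > 2`, in terms of `m = (p² - p) / 2` and the
number `r` of rows of `B_{3,1}`. -/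
def stackArrays (p m r : ℕ) : Set (Grid p) :=
  pairArray p p r (fun a => a) (fun _ b => b) (fun a b => 2 * (a + (b - 1) * p)) ∪
  pairArray p m m (fun a => p + a)
    (fun a b => b + if a ≤ (m + 1) / 2 ∧ (b = 2 * a - 1 ∨ b = 2 * a) then m else 0)
    (fun a b => 2 * p * r + 2 * (a + (b - 1) * m)) ∪
  pairArray p p (2 * m - r) (fun a => p + m + a) (fun _ b => r + b)
    (fun a b => 2 * (p * r + m * m) + 2 * (a + (b - 1) * p)) ∪
  pairArray p m m (fun a => p + m + p + a) (fun a b => b + if a = 1 then 0 else m)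
    (fun a b => 2 * (p * r + m * m + p * (2 * m - r)) + 2 * (a + (b - 1) * m))

theorem stackCells_points_eq {p m r : ℕ} (hm : 2 ≤ m) (hr : r ≤ 2 * m) :
    {x | ∃ s ∈ stackCells p m r, x ∈ layerPair p s.1 s.2 (2 * stackIndex p m r s)} =
      stackArrays p m r := by
  ext x
  simp only [stackArrays, pairArray, Set.mem_union, Set.mem_ofPred_eq,
    mem_stackCells (show 1 ≤ m by omega)]
  constructor
  · rintro ⟨s, hs, hx⟩
    obtain ⟨a, b, ha, hb, ⟨ha', hb', rfl, h⟩ | ⟨ha', hb', rfl, h⟩ | ⟨ha', hb', rfl, h⟩ |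
      ⟨ha', hb', rfl, h⟩⟩ := stackCell_cases hr hs <;> rw [h] at hx
    · exact Or.inl (Or.inl (Or.inl ⟨a, b, ha, ha', hb, hb', hx⟩))
    · refine Or.inl (Or.inl (Or.inr ⟨a, b, ha, ha', hb, hb', ?_⟩))
      rwa [mul_add, ← mul_assoc] at hx
    · refine Or.inl (Or.inr ⟨a, b, ha, ha', hb, hb', ?_⟩)
      rwa [mul_add 2 (_ + _)] at hx
    · refine Or.inr ⟨a, b, ha, ha', hb, hb', ?_⟩
      rwa [mul_add 2 (_ + _)] at hx
  · rintro (((⟨a, b, ha, ha', hb, hb', hx⟩ | ⟨a, b, ha, ha', hb, hb', hx⟩) |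
      ⟨a, b, ha, ha', hb, hb', hx⟩) | ⟨a, b, ha, ha', hb, hb', hx⟩)
    · obtain ⟨h, hk⟩ := isStackCell_first (p := p) hr ha ha' hb hb'
      exact ⟨(a, b), h, by rwa [hk]⟩
    · obtain ⟨h, hk⟩ := isStackCell_second (p := p) (r := r) hm ha ha' hb hb' rfl
      exact ⟨_, h, by rwa [hk, mul_add 2 (p * r), ← mul_assoc 2 p r]⟩
    · obtain ⟨h, hk⟩ := isStackCell_third (p := p) (m := m) ha ha' hb hb'
      exact ⟨_, h, by rwa [hk, mul_add 2 (_ + _)]⟩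
    · obtain ⟨h, hk⟩ := isStackCell_fourth (p := p) (r := r) ha ha' hb hb' rfl
      exact ⟨_, h, by rwa [hk, mul_add 2 (_ + _)]⟩

theorem block3Odd_eq {p m r : ℕ} (hpm : 2 * m + p = p ^ 2)
    (hr : 2 * r + 1 = p ^ 2) (hr' : r ≤ 2 * m) : block3Odd p = stackArrays p m r := by
  have hmQ : (m : ℚ) = ((p : ℚ) ^ 2 - p) / 2 := by
    have : (2 * m + p : ℚ) = p ^ 2 := by exact_mod_cast hpm
    linarith
  have hrQ : (r : ℚ) = ((p : ℚ) ^ 2 - 1) / 2 := by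
    have : (2 * r + 1 : ℚ) = p ^ 2 := by exact_mod_cast hr
    linarith
  have h1 : (p ^ 2 - 1) / 2 = r := by omega
  have h2 : (p ^ 2 - p) / 2 = m := by omega
  have h3 : (p ^ 2 - 2 * p + 1) / 2 = 2 * m - r := by omega
  have h4 : (p ^ 2 + p) / 2 = p + m := by omega
  have h5 : (p ^ 2 + 3 * p) / 2 = p + m + p := by omega
  have h6 : (p ^ 2 - p + 2) / 4 = (m + 1) / 2 := by omega
  have h7 : (p ^ 4 + p ^ 2 - 2 * p) / 4 = p * r + m * m := by
    have : p ^ 4 + p ^ 2 = 4 * (p * r + m * m) + 2 * p := by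
      qify
      rw [hmQ, hrQ]
      ring
    omega
  have h8 : (p ^ 4 + 2 * p ^ 3 - 3 * p ^ 2) / 4 = p * r + m * m + p * (2 * m - r) := by
    have : p ^ 4 + 2 * p ^ 3 = 4 * (p * r + m * m + p * (2 * m - r)) + 3 * p ^ 2 := by
      qify [hr']
      rw [hmQ, hrQ]
      ring
    omega
  simp only [block3Odd, stackArrays, shift32, shift34, h1, h2, h3, h4, h5, h6, h7, h8]

theorem block3Even_eq {p m r : ℕ} (hp : 2 < p) (hpm : 2 * m + p = p ^ 2)
    (hr : 2 * r + 2 * p = p ^ 2) (hr' : r ≤ 2 * m) : block3Even p = stackArrays p m r := by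
  have hmQ : (m : ℚ) = ((p : ℚ) ^ 2 - p) / 2 := by
    have : (2 * m + p : ℚ) = p ^ 2 := by exact_mod_cast hpm
    linarith
  have hrQ : (r : ℚ) = ((p : ℚ) ^ 2 - 2 * p) / 2 := by
    have : (2 * r + 2 * p : ℚ) = p ^ 2 := by exact_mod_cast hr
    linarith
  have h1 : (p ^ 2 - 2 * p) / 2 = r := by omega
  have h2 : (p ^ 2 - p) / 2 = m := by omega
  have h3 : p ^ 2 / 2 = 2 * m - r := by omega
  have h4 : (p ^ 2 + p) / 2 = p + m := by omega
  have h5 : (p ^ 2 + 3 * p) / 2 = p + m + p := by omega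
  have h6 : (p ^ 2 - p + 2) / 4 = (m + 1) / 2 := by omega
  have h7 : (p ^ 4 - 3 * p ^ 2) / 4 = p * r + m * m := by
    have : p ^ 4 = 4 * (p * r + m * m) + 3 * p ^ 2 := by
      qify
      rw [hmQ, hrQ]
      ring
    omega
  have h8 : (p ^ 4 + 2 * p ^ 3 - 3 * p ^ 2) / 4 = p * r + m * m + p * (2 * m - r) := by
    have : p ^ 4 + 2 * p ^ 3 = 4 * (p * r + m * m + p * (2 * m - r)) + 3 * p ^ 2 := by
      qify [hr']
      rw [hmQ, hrQ]
      ring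
    omega
  simp only [block3Even, stackArrays, shift32, shift34, h1, h2, h3, h4, h5, h6, h7, h8]

theorem exists_block3_eq_stackArrays {p : ℕ} (hp : 2 < p) :
    ∃ m r : ℕ, 2 ≤ m ∧ 2 * m + p = p ^ 2 ∧ (2 * r + 1 = p ^ 2 ∨ 2 * r + 2 * p = p ^ 2) ∧
      r ≤ 2 * m ∧ block3 p = stackArrays p m r := by
  have hpp : 3 * p ≤ p ^ 2 := by nlinarith
  have hblock : block3 p = if Odd p then block3Odd p else block3Even p := by
    unfold block3
    split
    · omega
    · rfl
  have hpm : 2 * ((p ^ 2 - p) / 2) + p = p ^ 2 := by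
    rcases Nat.even_or_odd p with h | h
    · have := h.pow_of_ne_zero two_ne_zero
      grind
    · have := h.pow (n := 2)
      grind
  rcases Nat.even_or_odd p with h | h
  · have hr : 2 * ((p ^ 2 - 2 * p) / 2) + 2 * p = p ^ 2 := by
      have := h.pow_of_ne_zero two_ne_zero
      grind
    refine ⟨(p ^ 2 - p) / 2, (p ^ 2 - 2 * p) / 2, by omega, hpm, Or.inr hr, by omega, ?_⟩
    rw [hblock, if_neg (Nat.not_odd_iff_even.2 h)]
    exact block3Even_eq hp hpm hr (by omega)
  · have hr : 2 * ((p ^ 2 - 1) / 2) + 1 = p ^ 2 := by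
      have := h.pow (n := 2)
      grind
    refine ⟨(p ^ 2 - p) / 2, (p ^ 2 - 1) / 2, by omega, hpm, Or.inl hr, by omega, ?_⟩
    rw [hblock, if_pos h]
    exact block3Odd_eq hpm hr (by omega)

theorem isDesign_designBlocks_of_two_lt {p : ℕ} (hp : 2 < p) :
    ∃ l : ℕ, IsDesign 2 (p ^ 8 + p ^ 4 + 1) (p ^ 4 + 1) l (designBlocks p) := by
  obtain ⟨m, r, hm, hpm, hr, hr', hblock⟩ := exists_block3_eq_stackArrays hp
  have hmem : ∀ s ∈ stackCells p m r, 1 ≤ stackIndex p m r s ∧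
      stackIndex p m r s ≤ p * r + m * m + p * (2 * m - r) + m * m := fun s hs =>
    stackIndex_bounds hr' ((mem_stackCells (by omega)).1 hs)
  refine isDesign_of_baseBlock_eq p (by omega) (balancedTriples_cells (by omega) hm hpm hr
    (fun s hs => (hmem s hs).1) (stackIndex_injOn (by omega) hr')) ?_ ?_
  · have e1 : gridSize p 0 = 1 + p + m + p + m := by
      rw [gridSize_zero]
      omega
    have e2 : gridSize p 1 = 1 + 2 * m := by
      rw [gridSize_one]
      omega
    apply layerSet_lt_gridSize
    · rw [e1, e2]
      exact flatCells_bound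
    · rw [e1, e2]
      exact stackCells_bound
    · intro s hs
      have htop : p ^ 4 = 2 * (p * r + m * m + p * (2 * m - r) + m * m) + p ^ 2 := by
        have hmQ : (m : ℚ) = ((p : ℚ) ^ 2 - p) / 2 := by
          have : (2 * m + p : ℚ) = p ^ 2 := by exact_mod_cast hpm
          linarith
        qify [hr']
        rw [hmQ]
        ring
      have := (hmem s hs).2
      rw [gridSize_two]
      omega
  · rw [image_layerSet, flatCells_points_eq (by omega), stackCells_points_eq hm hr', ← hblock]
    rfl

/-- For `p = 2`, the cells under `B₃` form a single rectangle. -/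
theorem block3Two_points_eq :
    {x | ∃ s ∈ Finset.Icc 4 6 ×ˢ Finset.Icc 1 2,
      x ∈ layerPair 2 s.1 s.2 (2 * (s.1 - 3 + 3 * (s.2 - 1)))} = block3 2 := by
  change _ = block3Two
  ext x
  simp only [block3Two, pairArray, Set.mem_ofPred_eq, Finset.mem_product, Finset.mem_Icc]
  constructor
  · rintro ⟨⟨a, b⟩, ⟨⟨ha, ha'⟩, hb, hb'⟩, hx⟩
    dsimp only at ha ha' hb hb' hx
    refine ⟨a - 3, b, by omega, by omega, hb, hb', ?_⟩
    rwa [show 3 + (a - 3) = a by omega]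
  · rintro ⟨a, b, ha, ha', hb, hb', hx⟩
    refine ⟨(3 + a, b), by dsimp only; omega, ?_⟩
    dsimp only
    rwa [Nat.add_sub_cancel_left]

theorem isDesign_designBlocks_two :
    ∃ l : ℕ, IsDesign 2 (2 ^ 8 + 2 ^ 4 + 1) (2 ^ 4 + 1) l (designBlocks 2) := by
  refine isDesign_of_baseBlock_eq 2 (by omega)
    (Q := layerSet (flatCells 2 1) (Finset.Icc 4 6 ×ˢ Finset.Icc 1 2)
      fun s => s.1 - 3 + 3 * (s.2 - 1)) ?_ ?_ ?_
  · change BalancedTriples _ 16 7 3 13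
    refine balancedTriples_layerSet (by decide) ?_ (by decide) (by decide) (by decide) (by decide)
      (by decide) (by decide) (by decide) (by decide) (by decide) (by decide)
    have : ∀ s ∈ Finset.Icc 4 6 ×ˢ Finset.Icc 1 2, ∀ t ∈ Finset.Icc 4 6 ×ˢ Finset.Icc 1 2,
        s.1 - 3 + 3 * (s.2 - 1) = t.1 - 3 + 3 * (t.2 - 1) → s = t := by decide
    exact fun s hs t ht h => this s hs t ht h
  · apply layerSet_lt_gridSize <;> decide
  · rw [image_layerSet, flatCells_points_eq (by norm_num), block3Two_points_eq]
    rfl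

/-- For every `p > 1`, the incidence structure `D(3, p)` is a `2`-`(p⁸ + p⁴ + 1, p⁴ + 1, l)`
design for some `l`, and `G` is a group of automorphisms of it that is block-transitive and
`3`-grid-imprimitive, with respect to the grid `ℤ_{e₁} × ℤ_{e₂} × ℤ_{e₃}`. -/
theorem propositionp (p : ℕ) (hp : 1 < p) :
    (∃ l : ℕ, IsDesign 2 (p ^ 8 + p ^ 4 + 1) (p ^ 4 + 1) l (designBlocks p)) ∧
    IsBlockTransitive (baseGroup p) (designBlocks p) ∧
    IsGridImprimitive 3 (baseGroup p) ∧
    IsGridImprimitiveVia (Equiv.refl (Grid p)) (baseGroup p) := by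
  have hgrid : IsGridImprimitiveVia (Equiv.refl (Grid p)) (baseGroup p) := by
    have (i : Fin 3) : NeZero (gridSize p i) := ⟨(zero_lt_one.trans (one_lt_gridSize p hp i)).ne'⟩
    refine isGridImprimitiveVia_refl (by omega) (fun i => inferInstance) fun i => ?_
    rw [Nat.card_zmod]
    exact one_lt_gridSize p hp i
  refine ⟨?_, isBlockTransitive_blockOrbit _ _, ⟨_, _, hgrid⟩, hgrid⟩
  rcases (Nat.succ_le_of_lt hp).eq_or_lt with rfl | h
  · exact isDesign_designBlocks_two
  · exact isDesign_designBlocks_of_two_lt h
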